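/- For complex $q$ with $|q|<1$ let $$\varphi(q)=\sum_{n=-\infty}^{\infty}q^{n^2},\qquad \psi(q)=\sum_{n=-\infty}^{\infty}q^{2n^2-n},$$ and let $\left(\frac{n}{5}\right)$ denote the Legendre symbol modulo $5$ (equal to $0$ if $5\mid n$). Then for every complex $q$ with $|q|<1$ all the series below converge absolutely, and $$\varphi(q)\varphi^3(q^5)=1+\sum_{n=1}^{\infty}\left(\frac n5\right)\frac{nq^n}{1-(-q)^n}-\sum_{n=1}^{\infty}\left(\frac n5\right)\frac{(-q)^n}{(1+(-q)^n)^2},$$ $$\varphi^3(q)\varphi(q^5)=1+\sum_{n=1}^{\infty}\left(\frac n5\right)\frac{nq^n}{1-(-q)^n}-5\sum_{n=1}^{\infty}\left(\frac n5\right)\frac{(-q)^n}{(1+(-q)^n)^2},$$ $$4q\psi^3(q)\psi(q^5)=-\sum_{n=1}^{\infty}\left(\frac n5\right)\frac{nq^n}{1-q^{2n}}+5\sum_{\substack{n=1\\ n\text{ odd}}}^{\infty}\left(\frac n5\right)\frac{q^n}{(1-q^n)^2},$$ $$4q^2\psi(q)\psi^3(q^5)=-\sum_{n=1}^{\infty}\left(\frac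 n5\right)\frac{nq^n}{1-q^{2n}}+\sum_{\substack{n=1\\ n\text{ odd}}}^{\infty}\left(\frac n5\right)\frac{q^n}{(1-q^n)^2}.$$ -/

import Mathlib

/-- The `n`-th term of Ramanujan's general theta series,
`a ^ (n (n + 1) / 2) * b ^ (n (n - 1) / 2)`. Both integer divisions are exact and both
exponents are nonnegative for every integer `n`. -/
noncomputable def ramanujanThetaTerm (a b : ℂ) (n : ℤ) : ℂ :=
  a ^ (n * (n + 1) / 2) * b ^ (n * (n - 1) / 2)

/-- Ramanujan's general theta function `f(a, b)`, for `|a b| < 1`. -/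
noncomputable def ramanujanTheta (a b : ℂ) : ℂ :=
  ∑' n : ℤ, ramanujanThetaTerm a b n

/-- Ramanujan's `φ(q) = f(q, q)`, the sum of `q ^ (n ^ 2)` over all integers `n`. -/
noncomputable def ramanujanPhi (q : ℂ) : ℂ := ramanujanTheta q q

/-- Ramanujan's `ψ(q) = f(q, q ^ 3)`, the sum of `q ^ (2 n ^ 2 - n)` over all integers `n`. -/
noncomputable def ramanujanPsi (q : ℂ) : ℂ := ramanujanTheta q (q ^ 3)

instance fact_prime_five_nat : Fact (Nat.Prime 5) := ⟨by norm_num⟩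

/-- The Legendre symbol `(n / 5)`, as a complex number. -/
def legendreFive (n : ℕ) : ℂ := ((legendreSym 5 (n : ℤ) : ℤ) : ℂ)

/-! Both sides of every expansion reduce to eta quotients. Write E_k = (q^k; q^k)_∞. The Jacobi
triple product gives φ(-q) = E_1²/E_2 and ψ(q) = E_2²/E_1; for this reason the φ expansions are
proved at -q. Each Lambert series is a difference of two values of the ℘-like sum `koebeSum`. For
the series with squared denominators one groups n by residue; for those with numerator n q^n one
expands (n/5) in fifth roots of unity by the Gauss sum and 1/(1 - b^n) geometrically. A difference
of two values of ℘ is a single theta quotient (`koebeSum_sub`), which at the points needed here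
collapses to an eta quotient. The engine is `thetaProd_three_term`. A product θ(xy)θ(x/y) is, up to
a factor, a 2×2 determinant in vectors attached to x and y, so the relation is the Plücker relation
for four vectors in a plane. Letting one variable tend to 1 gives `koebeSum_sub`. Special values
give `eulerProd_identity_one` and `eulerProd_identity_five`, two linear relations between eta
quotients: each yields one φ expansion, and eliminating between them yields the ψ expansions, with
the factor 4 = 5 - 1. -/

open Filter Topology

/-! ### Infinite q-Pochhammer products -/

/-- The infinite `q`-Pochhammer symbol `(a; p)_∞`. -/
noncomputable def qPoch (a p : ℂ) : ℂ := ∏' n : ℕ, (1 - a * p ^ n)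

lemma summable_mul_pow {p : ℂ} (hp : ‖p‖ < 1) (a : ℂ) : Summable fun n : ℕ => a * p ^ n :=
  (summable_geometric_of_norm_lt_one hp).mul_left a

lemma multipliable_one_sub_mul_pow {p : ℂ} (hp : ‖p‖ < 1) (a : ℂ) :
    Multipliable fun n : ℕ => 1 - a * p ^ n := by
  have := multipliable_one_add_of_summable (f := fun n : ℕ => -(a * p ^ n))
    (by simpa using (summable_mul_pow hp a).norm)
  simpa [sub_eq_add_neg] using this

lemma tprod_ne_zero_of_summable {f : ℕ → ℂ} (hf : Summable f) (h : ∀ n, 1 + f n ≠ 0) :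
    ∏' n, (1 + f n) ≠ 0 := by
  exact tprod_one_add_ne_zero_of_summable h hf.norm

lemma qPoch_ne_zero {p : ℂ} (hp : ‖p‖ < 1) {a : ℂ} (h : ∀ n : ℕ, 1 - a * p ^ n ≠ 0) :
    qPoch a p ≠ 0 := by
  have := tprod_ne_zero_of_summable (f := fun n : ℕ => -(a * p ^ n)) (summable_mul_pow hp a).neg
    (fun n => by simpa [sub_eq_add_neg] using h n)
  simpa [qPoch, sub_eq_add_neg] using this

lemma one_sub_mul_pow_ne_zero {a p : ℂ} (ha : ‖a‖ < 1) (hp : ‖p‖ < 1) (n : ℕ) :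
    1 - a * p ^ n ≠ 0 := by
  intro h
  have h1 : ‖a * p ^ n‖ = 1 := by rw [← sub_eq_zero.mp h]; simp
  have h2 : ‖a * p ^ n‖ ≤ ‖a‖ := by
    rw [norm_mul, norm_pow]
    exact mul_le_of_le_one_right (norm_nonneg a) (pow_le_one₀ (norm_nonneg p) hp.le)
  linarith

lemma qPoch_ne_zero_of_norm_lt_one {a p : ℂ} (ha : ‖a‖ < 1) (hp : ‖p‖ < 1) : qPoch a p ≠ 0 :=
  qPoch_ne_zero hp (one_sub_mul_pow_ne_zero ha hp)

lemma qPoch_eq_one_sub_mul {p : ℂ} (hp : ‖p‖ < 1) (a : ℂ) :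
    qPoch a p = (1 - a) * qPoch (a * p) p := by
  rw [qPoch, tprod_eq_zero_mul']
  · simp [qPoch, pow_succ', mul_assoc]
  · simpa [pow_succ', mul_assoc] using multipliable_one_sub_mul_pow hp (a * p)

/-! ### The Jacobi triple product -/

/-- The theta product `(x; p)_∞ (p / x; p)_∞`. -/
noncomputable def thetaProd (x p : ℂ) : ℂ := qPoch x p * qPoch (p / x) p

/-- The term of the theta series `∑ (-x) ^ n p ^ (n (n - 1) / 2)`. -/
noncomputable def thetaTerm (x p : ℂ) (n : ℤ) : ℂ := (-x) ^ n * p ^ (n * (n - 1) / 2)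

lemma triangle_succ (n : ℤ) : (n + 1) * (n + 1 - 1) / 2 = n * (n - 1) / 2 + n := by
  rw [show (n + 1) * (n + 1 - 1) = n * (n - 1) + n * 2 by ring,
    Int.add_mul_ediv_right _ _ two_ne_zero]

lemma triangle_mul_two (n : ℤ) : n * (n - 1) / 2 * 2 = n * (n - 1) :=
  Int.ediv_mul_cancel (by simpa using (Int.even_mul_pred_self n).two_dvd)

lemma thetaTerm_succ {x p : ℂ} (hx : x ≠ 0) (hp : p ≠ 0) (n : ℤ) :
    thetaTerm x p (n + 1) = -x * p ^ n * thetaTerm x p n := by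
  rw [thetaTerm, thetaTerm, triangle_succ, zpow_add₀ hp, zpow_add_one₀ (neg_ne_zero.mpr hx)]
  ring

lemma thetaTerm_ne_zero {x p : ℂ} (hx : x ≠ 0) (hp : p ≠ 0) (n : ℤ) : thetaTerm x p n ≠ 0 :=
  mul_ne_zero (zpow_ne_zero _ (neg_ne_zero.mpr hx)) (zpow_ne_zero _ hp)

lemma summable_thetaTerm_nat {x p : ℂ} (hx : x ≠ 0) (hp : p ≠ 0) (hp1 : ‖p‖ < 1) :
    Summable fun n : ℕ => thetaTerm x p n := by
  refine summable_of_ratio_test_tendsto_lt_one (l := 0) one_pos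
    (Eventually.of_forall fun n => thetaTerm_ne_zero hx hp _) ?_
  have h : ∀ n : ℕ, ‖thetaTerm x p (n + 1 : ℕ)‖ / ‖thetaTerm x p n‖ = ‖x‖ * ‖p‖ ^ n := by
    intro n
    have := norm_ne_zero_iff.mpr (thetaTerm_ne_zero hx hp (n : ℤ))
    push_cast
    rw [thetaTerm_succ hx hp, norm_mul, mul_div_assoc, div_self this]
    simp
  simp_rw [h]
  simpa using (tendsto_pow_atTop_nhds_zero_of_lt_one (norm_nonneg p) hp1).const_mul ‖x‖

lemma thetaTerm_neg {x p : ℂ} (hp : p ≠ 0) (n : ℤ) :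
    thetaTerm x p (-n) = thetaTerm (p / x) p n := by
  rw [thetaTerm, thetaTerm]
  have : (-n) * (-n - 1) / 2 = n * (n - 1) / 2 + n := by
    rw [← triangle_succ]; congr 1; ring
  rw [this, zpow_add₀ hp, ← neg_div, zpow_neg, ← inv_zpow, neg_div, neg_eq_neg_one_mul (p / x),
    mul_zpow, div_zpow, neg_eq_neg_one_mul x, mul_inv, mul_zpow, inv_zpow x]
  norm_num
  ring

lemma summable_thetaTerm {x p : ℂ} (hx : x ≠ 0) (hp : p ≠ 0) (hp1 : ‖p‖ < 1) :
    Summable (thetaTerm x p) := by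
  refine Summable.of_nat_of_neg (summable_thetaTerm_nat hx hp hp1) ?_
  simpa only [thetaTerm_neg hp] using summable_thetaTerm_nat (div_ne_zero hp hx) hp hp1

/-- `1 / (p; p)_n`, extended by zero to negative `n`. -/
noncomputable def invPoch (p : ℂ) (n : ℤ) : ℂ :=
  if n < 0 then 0 else (∏ k ∈ Finset.range n.toNat, (1 - p * p ^ k))⁻¹

lemma invPoch_natCast (p : ℂ) (n : ℕ) :
    invPoch p n = (∏ k ∈ Finset.range n, (1 - p * p ^ k))⁻¹ := by
  simp [invPoch]

/-- The extension by zero makes the recurrence hold on all of ℤ: at n = -1 the factor 1 - p^0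
vanishes. Hence the induction below has no boundary cases. -/
lemma invPoch_succ {p : ℂ} (hp1 : ‖p‖ < 1) (n : ℤ) :
    (1 - p ^ (n + 1)) * invPoch p (n + 1) = invPoch p n := by
  rcases lt_trichotomy n (-1) with h | rfl | h
  · simp [invPoch, show n + 1 < 0 by lia, show n < 0 by lia]
  · simp [invPoch]
  · obtain ⟨m, rfl⟩ := Int.eq_ofNat_of_zero_le (show 0 ≤ n by lia)
    have h1 := one_sub_mul_pow_ne_zero hp1 hp1 m
    have h2 := invPoch_natCast p (m + 1)
    push_cast at h2
    rw [h2, invPoch_natCast, Finset.prod_range_succ, mul_inv, ← Nat.cast_succ, zpow_natCast,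
      Nat.succ_eq_add_one, pow_succ']
    field_simp

/-- Cauchy's finite form: the coefficients are the q-binomials [2N, N+j], which vanish for |j| > N.
Raising N by one multiplies the product by (1 - x p^N)(1 - p^(N+1)/x) = 1 + p^(2N+1) - x p^N -
p^(N+1)/x. -/
lemma hasSum_finite_triple_product {x p : ℂ} (hx : x ≠ 0) (hp : p ≠ 0) (hp1 : ‖p‖ < 1) (N : ℕ) :
    HasSum (fun j : ℤ => (∏ k ∈ Finset.range (2 * N), (1 - p * p ^ k)) *
        (invPoch p (N - j) * invPoch p (N + j)) * thetaTerm x p j)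
      ((∏ k ∈ Finset.range N, (1 - x * p ^ k)) * ∏ k ∈ Finset.range N, (1 - p / x * p ^ k)) := by
  induction N with
  | zero =>
    convert hasSum_ite_eq (0 : ℤ) (1 : ℂ) using 2 with j
    · rcases lt_trichotomy j 0 with h | rfl | h
      · simp [invPoch, h, h.ne]
      · simp [invPoch, thetaTerm]
      · simp [invPoch, h, h.ne']
    · simp
  | succ N ih =>
    -- Multiplication by x or x⁻¹ is absorbed by shifting j by one, so that all terms become
    -- multiples of `thetaTerm x p j`.
    have s1 := ((Equiv.subRight (1 : ℤ)).hasSum_iff (a := x *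
      ((∏ k ∈ Finset.range N, (1 - x * p ^ k)) * ∏ k ∈ Finset.range N, (1 - p / x * p ^ k)))
      ).mpr (ih.mul_left x)
    have s2 := ((Equiv.addRight (1 : ℤ)).hasSum_iff (a := x⁻¹ *
      ((∏ k ∈ Finset.range N, (1 - x * p ^ k)) * ∏ k ∈ Finset.range N, (1 - p / x * p ^ k)))
      ).mpr (ih.mul_left x⁻¹)
    convert ((ih.mul_left (1 + p ^ (2 * N + 1))).sub (s1.mul_left (p ^ N))).sub
      (s2.mul_left (p ^ (N + 1))) using 1
    · rfl
    · funext j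
      simp only [Function.comp, Equiv.subRight_apply, Equiv.coe_addRight]
      have t1 := thetaTerm_succ hx hp (j - 1)
      rw [sub_add_cancel] at t1
      have t1' : x * thetaTerm x p (j - 1) = - (p * p ^ (-j)) * thetaTerm x p j := by
        rw [t1, zpow_sub₀ hp, zpow_neg]
        have := zpow_ne_zero j hp
        field_simp
      have t2 := thetaTerm_succ hx hp j
      have r1 := invPoch_succ hp1 ((N : ℤ) - j)
      have r2 := invPoch_succ hp1 ((N : ℤ) - j - 1)
      have r3 := invPoch_succ hp1 ((N : ℤ) + j)
      have r4 := invPoch_succ hp1 ((N : ℤ) + j - 1)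
      rw [sub_add_cancel] at r2 r4
      have e1 : ((N + 1 : ℕ) : ℤ) - j = N - j + 1 := by push_cast; ring
      have e2 : ((N + 1 : ℕ) : ℤ) + j = N + j + 1 := by push_cast; ring
      have e3 : (N : ℤ) - (j - 1) = N - j + 1 := by ring
      have e4 : (N : ℤ) + (j - 1) = N + j - 1 := by ring
      have e5 : (N : ℤ) - (j + 1) = N - j - 1 := by ring
      have e6 : (N : ℤ) + (j + 1) = N + j + 1 := by ring
      rw [e1, e2, e3, e4, e5, e6, ← r2, ← r4, ← r1, ← r3, t2,
        show 2 * (N + 1) = 2 * N + 1 + 1 by ring, Finset.prod_range_succ, Finset.prod_range_succ]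
      generalize invPoch p (↑N - j + 1) = A
      generalize invPoch p (↑N + j + 1) = B
      generalize (∏ k ∈ Finset.range (2 * N), (1 - p * p ^ k)) = C
      rw [zpow_add_one₀ hp, zpow_add_one₀ hp, zpow_sub₀ hp, zpow_add₀ hp, zpow_natCast]
      have h3 : ∀ a b : ℂ, p ^ N * (x * (a * b * thetaTerm x p (j - 1))) =
          p ^ N * (a * b * (x * thetaTerm x p (j - 1))) := fun a b => by ring
      rw [h3, t1', zpow_neg]
      have h0 := zpow_ne_zero j hp
      field_simp
      ring
    · rw [Finset.prod_range_succ, Finset.prod_range_succ]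
      field_simp
      ring

lemma tendsto_prod_qPoch {p : ℂ} (hp : ‖p‖ < 1) (a : ℂ) :
    Tendsto (fun N : ℕ => ∏ k ∈ Finset.range N, (1 - a * p ^ k)) atTop (𝓝 (qPoch a p)) :=
  (multipliable_one_sub_mul_pow hp a).hasProd.tendsto_prod_nat

/-- The Jacobi triple product identity. -/
theorem tsum_thetaTerm {x p : ℂ} (hx : x ≠ 0) (hp : p ≠ 0) (hp1 : ‖p‖ < 1) :
    ∑' n : ℤ, thetaTerm x p n = qPoch p p * thetaProd x p := by
  have hE := qPoch_ne_zero_of_norm_lt_one hp1 hp1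
  -- The finite identity passes to the limit by dominated convergence: the q-binomials are bounded
  -- uniformly in N and j, and tend to 1/(p; p)_∞ for each j.
  have hr : Tendsto (fun n : ℕ => invPoch p n) atTop (𝓝 (qPoch p p)⁻¹) := by
    simp_rw [invPoch_natCast]
    exact (tendsto_prod_qPoch hp1 p).inv₀ hE
  obtain ⟨M, hM⟩ : ∃ M, ∀ n : ℤ, ‖invPoch p n‖ ≤ M := by
    obtain ⟨M, hM⟩ := (Metric.isBounded_range_of_tendsto _ hr).exists_norm_le
    refine ⟨M, fun n => ?_⟩
    rcases lt_or_ge n 0 with h | h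
    · simp only [invPoch, h, if_true, norm_zero]
      exact (norm_nonneg _).trans (hM _ ⟨0, rfl⟩)
    · obtain ⟨m, rfl⟩ := Int.eq_ofNat_of_zero_le h
      exact hM _ ⟨m, rfl⟩
  obtain ⟨K, hK⟩ := (Metric.isBounded_range_of_tendsto _ (tendsto_prod_qPoch hp1 p)).exists_norm_le
  have hM0 : 0 ≤ M := (norm_nonneg _).trans (hM 0)
  have hshift : ∀ j : ℤ, Tendsto (fun N : ℕ => invPoch p (N + j)) atTop (𝓝 (qPoch p p)⁻¹) := by
    intro j
    have h : Tendsto (fun N : ℕ => ((N : ℤ) + j).toNat) atTop atTop := by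
      refine tendsto_atTop.mpr fun b => ?_
      filter_upwards [eventually_ge_atTop (b + j.natAbs)] with N hN
      lia
    refine (hr.comp h).congr' ?_
    filter_upwards [eventually_ge_atTop j.natAbs] with N hN
    simp only [Function.comp]
    rw [Int.toNat_of_nonneg (by lia)]
  have h1 : Tendsto (fun N : ℕ => ∑' j : ℤ, (∏ k ∈ Finset.range (2 * N), (1 - p * p ^ k)) *
        (invPoch p (N - j) * invPoch p (N + j)) * thetaTerm x p j) atTop
        (𝓝 (∑' j : ℤ, (qPoch p p)⁻¹ * thetaTerm x p j)) := by
    refine tendsto_tsum_of_dominated_convergence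
      (bound := fun j => K * (M * M) * ‖thetaTerm x p j‖)
      ((summable_thetaTerm hx hp hp1).norm.mul_left _) (fun j => ?_)
      (Eventually.of_forall fun N j => ?_)
    · have := (((tendsto_prod_qPoch hp1 p).comp
        (tendsto_id.const_mul_atTop' (two_pos : (0 : ℕ) < 2))).mul
        ((hshift (-j)).mul (hshift j))).mul_const (thetaTerm x p j)
      simp only [Function.comp, id, ← sub_eq_add_neg] at this
      convert this using 2
      field_simp
    · rw [norm_mul, norm_mul, norm_mul]
      have hK' := hK _ ⟨2 * N, rfl⟩
      have hK0 := (norm_nonneg _).trans hK'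
      gcongr
      · exact hM _
      · exact hM _
  simp_rw [fun N => (hasSum_finite_triple_product hx hp hp1 N).tsum_eq] at h1
  have h2 := tendsto_nhds_unique h1
    ((tendsto_prod_qPoch hp1 x).mul (tendsto_prod_qPoch hp1 (p / x)))
  rw [tsum_mul_left] at h2
  rw [thetaProd, ← h2, mul_inv_cancel_left₀ hE]

lemma thetaProd_div {x p : ℂ} (hp : p ≠ 0) : thetaProd (p / x) p = thetaProd x p := by
  rw [thetaProd, thetaProd, div_div_cancel₀ hp, mul_comm]

lemma thetaProd_inv {x p : ℂ} (hx : x ≠ 0) (hp1 : ‖p‖ < 1) :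
    thetaProd x⁻¹ p = -x⁻¹ * thetaProd x p := by
  rw [thetaProd, thetaProd, qPoch_eq_one_sub_mul hp1 x⁻¹, qPoch_eq_one_sub_mul hp1 x,
    div_inv_eq_mul,
    inv_mul_eq_div, mul_comm p x]
  field_simp
  ring

/-! ### The three-term theta relation -/

lemma thetaTerm_neg_sq {z p : ℂ} (k : ℤ) :
    thetaTerm (-z) (p ^ 2) k = z ^ k * p ^ (k * (k - 1)) := by
  rw [thetaTerm, neg_neg, ← zpow_natCast p 2, ← zpow_mul, mul_comm ((2 : ℕ) : ℤ)]
  congr 2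
  exact triangle_mul_two k

/-- `∑ p ^ (k ^ 2) y ^ (2 k)`. -/
noncomputable def evenTheta (p y : ℂ) : ℂ := ∑' k : ℤ, thetaTerm (-(p * y ^ 2)) (p ^ 2) k

/-- `∑ p ^ (k ^ 2 + k) y ^ (2 k + 1)`. -/
noncomputable def oddTheta (p y : ℂ) : ℂ := y * ∑' k : ℤ, thetaTerm (-(p ^ 2 * y ^ 2)) (p ^ 2) k

lemma neg_zpow_sq (x : ℂ) (j : ℤ) : ((-x) ^ j) ^ 2 = (x ^ j) ^ 2 := by
  have h : ∀ a : ℂ, (a ^ j) ^ 2 = (a ^ 2) ^ j := fun a => by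
    rw [← zpow_natCast, ← zpow_mul, mul_comm, zpow_mul, zpow_natCast]
  rw [h, h, neg_sq]

lemma mul_zpow_mul_div_zpow {x y : ℂ} (hx : x ≠ 0) (hy : y ≠ 0) (j k : ℤ) :
    (-(x * y)) ^ (j + k) * (-(x / y)) ^ (j - k) = (x ^ j) ^ 2 * (y ^ k) ^ 2 := by
  have e1 : -(x * y) = -x * y := by ring
  have e2 : -(x / y) = -x / y := by ring
  have hx' := neg_ne_zero.mpr hx
  rw [e1, e2, mul_zpow, div_zpow, zpow_add₀ hx', zpow_add₀ hy, zpow_sub₀ hx', zpow_sub₀ hy,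
    ← neg_zpow_sq x]
  have := zpow_ne_zero j hx'
  have := zpow_ne_zero k hx'
  have := zpow_ne_zero j hy
  have := zpow_ne_zero k hy
  field_simp

lemma thetaTerm_mul_even {x y p : ℂ} (hx : x ≠ 0) (hy : y ≠ 0) (hp : p ≠ 0) (j k : ℤ) :
    thetaTerm (x * y) p (j + 1 + k) * thetaTerm (x / y) p (j + 1 - k) =
      x ^ 2 * (thetaTerm (-(p ^ 2 * x ^ 2)) (p ^ 2) j * thetaTerm (-(p * y ^ 2)) (p ^ 2) k) := by
  have h : (j + 1 + k) * (j + 1 + k - 1) / 2 + (j + 1 - k) * (j + 1 - k - 1) / 2 =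
      2 * j + j * (j - 1) + (k + k * (k - 1)) := by
    apply mul_right_cancel₀ (two_ne_zero' ℤ)
    linear_combination triangle_mul_two (j + 1 + k) + triangle_mul_two (j + 1 - k)
  rw [thetaTerm_neg_sq, thetaTerm_neg_sq, thetaTerm, thetaTerm,
    mul_mul_mul_comm ((-(x * y)) ^ _), mul_zpow_mul_div_zpow hx hy, ← zpow_add₀ hp, h,
    zpow_add₀ hp, zpow_add₀ hp, zpow_add₀ hp, zpow_add_one₀ hx, mul_zpow, mul_zpow,
    zpow_mul p 2 j]
  simp only [← zpow_natCast, ← zpow_mul, mul_comm, mul_zpow]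
  push_cast
  ring

lemma thetaTerm_mul_odd {x y p : ℂ} (hx : x ≠ 0) (hy : y ≠ 0) (hp : p ≠ 0) (j k : ℤ) :
    thetaTerm (x * y) p (j + 1 + k) * thetaTerm (x / y) p (j - k) =
      -(x * y) * (thetaTerm (-(p * x ^ 2)) (p ^ 2) j *
        thetaTerm (-(p ^ 2 * y ^ 2)) (p ^ 2) k) := by
  have h : (j + 1 + k) * (j + 1 + k - 1) / 2 + (j - k) * (j - k - 1) / 2 =
      j + j * (j - 1) + (2 * k + k * (k - 1)) := by
    apply mul_right_cancel₀ (two_ne_zero' ℤ)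
    linear_combination triangle_mul_two (j + 1 + k) + triangle_mul_two (j - k)
  have h1 : (-(x * y)) ^ (j + 1 + k) = (-(x * y)) ^ (j + k) * -(x * y) := by
    rw [← zpow_add_one₀ (neg_ne_zero.mpr (mul_ne_zero hx hy))]
    congr 1
    ring
  have h2 := mul_zpow_mul_div_zpow hx hy j k
  have h3 : p ^ ((j + 1 + k) * (j + 1 + k - 1) / 2) * p ^ ((j - k) * (j - k - 1) / 2) =
      p ^ j * p ^ (j * (j - 1)) * ((p ^ 2) ^ k * p ^ (k * (k - 1))) := by
    rw [← zpow_add₀ hp, h, zpow_add₀ hp, zpow_add₀ hp, zpow_add₀ hp, zpow_mul p 2 k]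
    rfl
  have h4 : ∀ (a : ℂ) (m : ℤ), (a ^ 2) ^ m = (a ^ m) ^ 2 := fun a m => by
    rw [← zpow_natCast (a ^ m), ← zpow_mul, mul_comm, zpow_mul, zpow_natCast]
  rw [thetaTerm_neg_sq, thetaTerm_neg_sq, thetaTerm, thetaTerm, h1, mul_zpow, mul_zpow,
    h4 x, h4 y]
  linear_combination -(x * y) * (p ^ ((j + 1 + k) * (j + 1 + k - 1) / 2) *
    p ^ ((j - k) * (j - k - 1) / 2)) * h2 + -(x * y) * ((x ^ j) ^ 2 * (y ^ k) ^ 2) * h3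

/-- Sum and difference coordinates reach only pairs of equal parity, so ℤ² needs two charts. The
shift j + 1 in the first one makes the factors match `oddTheta` at x and `evenTheta` at y. -/
lemma tsum_int_prod_parity {f : ℤ × ℤ → ℂ} (hf : Summable f) :
    ∑' z, f z = ∑' z : ℤ × ℤ, f (z.1 + 1 + z.2, z.1 + 1 - z.2) +
      ∑' z : ℤ × ℤ, f (z.1 + 1 + z.2, z.1 - z.2) := by
  set g0 : ℤ × ℤ → ℤ × ℤ := fun z => (z.1 + 1 + z.2, z.1 + 1 - z.2)
  set g1 : ℤ × ℤ → ℤ × ℤ := fun z => (z.1 + 1 + z.2, z.1 - z.2)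
  have i0 : Function.Injective g0 := by
    rintro ⟨a, b⟩ ⟨c, d⟩ h
    simp only [g0, Prod.mk.injEq] at h ⊢
    lia
  have i1 : Function.Injective g1 := by
    rintro ⟨a, b⟩ ⟨c, d⟩ h
    simp only [g1, Prod.mk.injEq] at h ⊢
    lia
  have hc : IsCompl (Set.range g0) (Set.range g1) := by
    constructor
    · rw [Set.disjoint_iff]
      rintro ⟨a, b⟩ ⟨⟨⟨c, d⟩, h⟩, ⟨⟨c', d'⟩, h'⟩⟩
      simp only [g0, g1, Prod.mk.injEq] at h h'
      exact absurd h (by lia)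
    · rw [codisjoint_iff_le_sup]
      rintro ⟨a, b⟩ -
      rcases Int.even_or_odd' (a + b) with ⟨c, h | h⟩
      · exact Or.inl ⟨(c - 1, a - c), by simp only [g0, Prod.mk.injEq]; lia⟩
      · exact Or.inr ⟨(c, a - c - 1), by simp only [g1, Prod.mk.injEq]; lia⟩
  refine (HasSum.add_isCompl hc (a := ∑' z, f (g0 z)) (b := ∑' z, f (g1 z)) ?_ ?_).tsum_eq
  · exact i0.hasSum_range_iff.mpr (hf.comp_injective i0).hasSum
  · exact i1.hasSum_range_iff.mpr (hf.comp_injective i1).hasSum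

/-- The right side is x times the determinant of the vectors (`oddTheta`, `evenTheta`) at x and y;
the two terms come from the two parity classes. -/
lemma tsum_thetaTerm_mul_tsum_thetaTerm {x y p : ℂ} (hx : x ≠ 0) (hy : y ≠ 0) (hp : p ≠ 0)
    (hp1 : ‖p‖ < 1) :
    (∑' n : ℤ, thetaTerm (x * y) p n) * ∑' n : ℤ, thetaTerm (x / y) p n =
      x * (oddTheta p x * evenTheta p y - evenTheta p x * oddTheta p y) := by
  have s1 := (summable_thetaTerm (mul_ne_zero hx hy) hp hp1).norm
  have s2 := (summable_thetaTerm (div_ne_zero hx hy) hp hp1).norm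
  have hp2 : ‖p ^ 2‖ < 1 := by rw [norm_pow]; exact pow_lt_one₀ (norm_nonneg p) hp1 two_ne_zero
  have hs : ∀ {z : ℂ}, z ≠ 0 → Summable fun k => ‖thetaTerm (-z) (p ^ 2) k‖ := fun hz =>
    (summable_thetaTerm (neg_ne_zero.mpr hz) (pow_ne_zero 2 hp) hp2).norm
  rw [tsum_mul_tsum_of_summable_norm s1 s2,
    tsum_int_prod_parity (summable_mul_of_summable_norm s1 s2)]
  simp only [thetaTerm_mul_even hx hy hp, thetaTerm_mul_odd hx hy hp, tsum_mul_left]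
  rw [← tsum_mul_tsum_of_summable_norm (hs (by positivity)) (hs (by positivity)),
    ← tsum_mul_tsum_of_summable_norm (hs (by positivity)) (hs (by positivity)),
    evenTheta, evenTheta, oddTheta, oddTheta]
  ring

/-- The three-term theta relation (Weierstrass). -/
theorem thetaProd_three_term {x y u p : ℂ} (hx : x ≠ 0) (hy : y ≠ 0) (hu : u ≠ 0) (hp : p ≠ 0)
    (hp1 : ‖p‖ < 1) :
    y * thetaProd (x * y) p * thetaProd (x / y) p * thetaProd u p ^ 2 +
      u * thetaProd (y * u) p * thetaProd (y / u) p * thetaProd x p ^ 2 +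
      x * thetaProd (u * x) p * thetaProd (u / x) p * thetaProd y p ^ 2 = 0 := by
  have hE := qPoch_ne_zero_of_norm_lt_one hp1 hp1
  have key : ∀ {a b : ℂ}, a ≠ 0 → b ≠ 0 →
      qPoch p p ^ 2 * (thetaProd (a * b) p * thetaProd (a / b) p) =
        a * (oddTheta p a * evenTheta p b - evenTheta p a * oddTheta p b) := by
    intro a b ha hb
    rw [← tsum_thetaTerm_mul_tsum_thetaTerm ha hb hp hp1, tsum_thetaTerm (mul_ne_zero ha hb) hp hp1,
      tsum_thetaTerm (div_ne_zero ha hb) hp hp1]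
    ring
  have hsq : ∀ {a : ℂ}, a ≠ 0 → qPoch p p ^ 2 * thetaProd a p ^ 2 =
        a * (oddTheta p a * evenTheta p 1 - evenTheta p a * oddTheta p 1) := by
    intro a ha
    rw [← key ha one_ne_zero, mul_one, div_one]
    ring
  have h1 := key hx hy
  have h2 := key hy hu
  have h3 := key hu hx
  have h4 := hsq hx
  have h5 := hsq hy
  have h6 := hsq hu
  -- With [a b] the determinant above, the sum becomes xyu([x y][u 1] + [y u][x 1] + [u x][y 1]),
  -- which is zero by the Plücker relation.
  refine (mul_eq_zero.mp (?_ : qPoch p p ^ 4 * _ = 0)).resolve_left (pow_ne_zero 4 hE)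
  rw [show ∀ A B C D E F G H I : ℂ, qPoch p p ^ 4 * (y * A * B * C ^ 2 + u * D * E * F ^ 2 +
    x * G * H * I ^ 2) = y * ((qPoch p p ^ 2 * (A * B)) * (qPoch p p ^ 2 * C ^ 2)) +
    u * ((qPoch p p ^ 2 * (D * E)) * (qPoch p p ^ 2 * F ^ 2)) +
    x * ((qPoch p p ^ 2 * (G * H)) * (qPoch p p ^ 2 * I ^ 2)) by intros; ring,
    h1, h2, h3, h4, h5, h6]
  ring

/-! ### Differentiating the three-term relation: differences of ℘-values -/

lemma norm_prod_one_add_sub_le (t : Finset ℕ) (f : ℕ → ℂ) :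
    ‖∏ i ∈ t, (1 + f i) - 1 - ∑ i ∈ t, f i‖ ≤
      Real.exp (∑ i ∈ t, ‖f i‖) - 1 - ∑ i ∈ t, ‖f i‖ := by
  induction t using Finset.induction_on with
  | empty => simp
  | insert a t ha ih =>
    rw [Finset.prod_insert ha, Finset.sum_insert ha, Finset.sum_insert ha, Real.exp_add]
    have h1 : ‖f a * (∏ i ∈ t, (1 + f i) - 1)‖ ≤ ‖f a‖ * (Real.exp (∑ i ∈ t, ‖f i‖) - 1) := by
      rw [norm_mul]
      exact mul_le_mul_of_nonneg_left (Finset.norm_prod_one_add_sub_one_le t f) (norm_nonneg _)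
    have h2 := mul_le_mul_of_nonneg_right (Real.add_one_le_exp ‖f a‖)
      (Real.exp_nonneg (∑ i ∈ t, ‖f i‖))
    calc _ = ‖(∏ i ∈ t, (1 + f i) - 1 - ∑ i ∈ t, f i) + f a * (∏ i ∈ t, (1 + f i) - 1)‖ := by
          congr 1; ring
      _ ≤ _ := norm_add_le _ _
      _ ≤ _ := by linarith

/-- The linearization error of each partial product is at most e^s - 1 - s with s ≤ |ε|S. In the
limit the error is at most e^(|ε|S) - 1 - |ε|S = O(|ε|²). -/
lemma hasDerivAt_tprod_one_add_mul {g : ℕ → ℂ} (hg : Summable g) :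
    HasDerivAt (fun ε : ℂ => ∏' n, (1 + ε * g n)) (∑' n, g n) 0 := by
  have hgn := hg.norm
  set S := ∑' n, ‖g n‖
  have hS : 0 ≤ S := tsum_nonneg fun _ => norm_nonneg _
  have hb : ∀ ε : ℂ, ‖∏' n, (1 + ε * g n) - 1 - ∑' n, ε * g n‖ ≤
      Real.exp (‖ε‖ * S) - 1 - ‖ε‖ * S := by
    intro ε
    have hs : Summable fun n => ε * g n := hg.mul_left ε
    have t1 := (multipliable_one_add_of_summable hs.norm).hasProd.tendsto_prod_nat
    have t2 := hs.hasSum.tendsto_sum_nat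
    have t3 := hs.norm.hasSum.tendsto_sum_nat
    have e : ∑' n, ‖ε * g n‖ = ‖ε‖ * S := by simp only [norm_mul, tsum_mul_left, S]
    rw [e] at t3
    refine le_of_tendsto_of_tendsto' ((t1.sub_const 1).sub t2).norm
      (((Real.continuous_exp.tendsto _).comp t3).sub_const 1 |>.sub t3) fun N => ?_
    exact norm_prod_one_add_sub_le _ _
  rw [hasDerivAt_iff_isLittleO_nhds_zero]
  simp only [zero_add, zero_mul, add_zero, tprod_one, smul_eq_mul]
  refine (Asymptotics.IsBigO.trans_isLittleO (g := fun ε : ℂ => ε ^ 2) ?_ ?_)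
  · refine Asymptotics.IsBigO.of_bound (S ^ 2) ?_
    have : ∀ᶠ ε : ℂ in 𝓝 0, ‖ε‖ * S < 1 := by
      have : Tendsto (fun ε : ℂ => ‖ε‖ * S) (𝓝 0) (𝓝 (‖(0 : ℂ)‖ * S)) :=
        (continuous_norm.mul continuous_const).tendsto 0
      rw [norm_zero, zero_mul] at this
      exact this.eventually_lt_const one_pos
    filter_upwards [this] with ε hε
    have h := hb ε
    rw [tsum_mul_left] at h
    refine h.trans ?_
    have h2 := Real.abs_exp_sub_one_sub_id_le (x := ‖ε‖ * S)
      (by rw [abs_of_nonneg (by positivity)]; exact hε.le)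
    rw [norm_pow]
    calc _ ≤ _ := le_abs_self _
      _ ≤ _ := h2
      _ = _ := by ring
  · simpa using Asymptotics.isLittleO_pow_id (𝕜 := ℂ) (n := 2) (by norm_num)

/-- The term `t / (1 - t) ^ 2`. -/
noncomputable def koebe (t : ℂ) : ℂ := t / (1 - t) ^ 2

/-- Denominators tend to 1, so the terms are eventually at most 2|a p^n|; finitely many zero
denominators do no harm. -/
lemma summable_koebe {p : ℂ} (hp1 : ‖p‖ < 1) (a : ℂ) :
    Summable fun n : ℕ => koebe (a * p ^ n) := by
  have h0 : Tendsto (fun n : ℕ => a * p ^ n) atTop (𝓝 0) := by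
    simpa using (tendsto_pow_atTop_nhds_zero_of_norm_lt_one hp1).const_mul a
  have h1 : Tendsto (fun n : ℕ => ‖((1 - a * p ^ n) ^ 2)⁻¹‖) atTop (𝓝 1) := by
    have := (((h0.const_sub 1).pow 2).inv₀ (by norm_num)).norm
    simpa using this
  refine Summable.of_norm_bounded_eventually_nat
    (g := fun n : ℕ => 2 * ‖a * p ^ n‖) ((summable_mul_pow hp1 a).norm.mul_left 2) ?_
  filter_upwards [h1.eventually_le_const (show (1 : ℝ) < 2 by norm_num)] with n hn
  rw [koebe, div_eq_mul_inv, norm_mul, mul_comm]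
  gcongr

/-- `∑ x p ^ n / (1 - x p ^ n) ^ 2` over all integers `n`, a form of Weierstrass's `℘`. -/
noncomputable def koebeSum (x p : ℂ) : ℂ :=
  ∑' n : ℕ, koebe (x * p ^ n) + ∑' n : ℕ, koebe (p / x * p ^ n)

/-- Factor by factor, (1 - tv)(1 - t/v) = (1 - t)² - t(v - 1)²/v. Thus the product depends on v only
through ε = (v - 1)²/v, the variable in which the derivative is taken. -/
lemma qPoch_mul_qPoch_div {a v p : ℂ} (hv : v ≠ 0) (hp1 : ‖p‖ < 1)
    (ha : ∀ n : ℕ, 1 - a * p ^ n ≠ 0) :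
    qPoch (a * v) p * qPoch (a / v) p =
      qPoch a p ^ 2 * ∏' n : ℕ, (1 + (v - 1) ^ 2 / v * -koebe (a * p ^ n)) := by
  have m := multipliable_one_sub_mul_pow hp1
  have m2 : Multipliable fun n : ℕ => 1 + (v - 1) ^ 2 / v * -koebe (a * p ^ n) :=
    multipliable_one_add_of_summable ((summable_koebe hp1 a).neg.mul_left _).norm
  rw [qPoch, qPoch, qPoch, ← (m _).tprod_mul (m _), sq, ← (m _).tprod_mul (m _),
    ← ((m _).mul (m _)).tprod_mul m2]
  refine tprod_congr fun n => ?_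
  have := ha n
  rw [koebe]
  field_simp
  ring

/-- v is a root of v² - (2 + ε)v + 1. Since every ε is attained, an identity in v becomes an
identity of functions of ε. -/
lemma exists_sub_one_sq_div (ε : ℂ) : ∃ v : ℂ, v ≠ 0 ∧ (v - 1) ^ 2 / v = ε := by
  obtain ⟨s, hs⟩ := IsAlgClosed.exists_pow_nat_eq ((2 + ε) ^ 2 - 4) two_pos
  have h : ((2 + ε + s) / 2) ^ 2 - (2 + ε) * ((2 + ε + s) / 2) + 1 = 0 := by
    linear_combination hs / 4
  generalize (2 + ε + s) / 2 = v at h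
  have hv : v ≠ 0 := by
    rintro rfl
    simp at h
  exact ⟨v, hv, by rw [div_eq_iff hv]; linear_combination h⟩

lemma one_sub_mul_pow_ne_zero_of_ne_one {x p : ℂ} (hx : ‖x‖ ≤ 1) (hx' : x ≠ 1) (hp1 : ‖p‖ < 1)
    (n : ℕ) : 1 - x * p ^ n ≠ 0 := by
  cases n with
  | zero => simpa [sub_eq_zero] using hx'.symm
  | succ n =>
    have := one_sub_mul_pow_ne_zero (a := x * p) (p := p) ?_ hp1 n
    · rwa [pow_succ', ← mul_assoc]
    · rw [norm_mul]
      exact (mul_le_of_le_one_left (norm_nonneg p) hx).trans_lt hp1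

lemma norm_div_lt_one {x p : ℂ} (hx : ‖p‖ < ‖x‖) : ‖p / x‖ < 1 := by
  rw [norm_div]
  exact (div_lt_one ((norm_nonneg p).trans_lt hx)).mpr hx

/-- The infinite product of `1 - ε a p ^ n / (1 - a p ^ n) ^ 2`. -/
noncomputable def koebeProd (a p ε : ℂ) : ℂ := ∏' n : ℕ, (1 + ε * -koebe (a * p ^ n))

lemma hasDerivAt_koebeProd (a : ℂ) {p : ℂ} (hp1 : ‖p‖ < 1) :
    HasDerivAt (koebeProd a p) (-∑' n : ℕ, koebe (a * p ^ n)) 0 := by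
  rw [← tsum_neg]
  exact hasDerivAt_tprod_one_add_mul (summable_koebe hp1 a).neg

lemma koebeProd_zero (a p : ℂ) : koebeProd a p 0 = 1 := by simp [koebeProd]

lemma thetaProd_mul_thetaProd_div {x v p : ℂ} (hx : ‖p‖ < ‖x‖) (hx1 : ‖x‖ ≤ 1) (hx' : x ≠ 1)
    (hp1 : ‖p‖ < 1) (hv : v ≠ 0) :
    thetaProd (x * v) p * thetaProd (x / v) p = thetaProd x p ^ 2 *
      (koebeProd x p ((v - 1) ^ 2 / v) * koebeProd (p / x) p ((v - 1) ^ 2 / v)) := by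
  have h1 := qPoch_mul_qPoch_div hv hp1 (one_sub_mul_pow_ne_zero_of_ne_one hx1 hx' hp1)
  have h2 := qPoch_mul_qPoch_div hv hp1 (one_sub_mul_pow_ne_zero (norm_div_lt_one hx) hp1)
  rw [thetaProd, thetaProd, thetaProd, koebeProd, koebeProd, ← div_div, div_div_eq_mul_div,
    div_mul_eq_mul_div] at *
  linear_combination qPoch (p * v / x) p * qPoch (p / x / v) p * h1 + qPoch x p ^ 2 *
    (∏' n : ℕ, (1 + (v - 1) ^ 2 / v * -koebe (x * p ^ n))) * h2

lemma thetaProd_sq {v p : ℂ} (hp1 : ‖p‖ < 1) (hv : v ≠ 0) :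
    thetaProd v p ^ 2 = (v - 1) ^ 2 * (qPoch p p ^ 2 * koebeProd p p ((v - 1) ^ 2 / v)) ^ 2 := by
  have h1 := qPoch_mul_qPoch_div hv hp1 (one_sub_mul_pow_ne_zero hp1 hp1)
  rw [koebeProd, ← h1, thetaProd, qPoch_eq_one_sub_mul hp1 v, mul_comm v p]
  ring

/-- The difference of two values of `koebeSum` as a theta quotient. The hypotheses keep `x` and
`y` off the zeros `p ^ n` of the theta product. -/
theorem koebeSum_sub {x y p : ℂ} (hx : ‖p‖ < ‖x‖) (hx1 : ‖x‖ ≤ 1) (hx' : x ≠ 1)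
    (hy : ‖p‖ < ‖y‖) (hy1 : ‖y‖ ≤ 1) (hy' : y ≠ 1) (hp : p ≠ 0) (hp1 : ‖p‖ < 1) :
    (koebeSum y p - koebeSum x p) * (thetaProd x p ^ 2 * thetaProd y p ^ 2) =
      y * qPoch p p ^ 4 * (thetaProd (x * y) p * thetaProd (x / y) p) := by
  have hx0 : x ≠ 0 := norm_pos_iff.mp ((norm_nonneg p).trans_lt hx)
  have hy0 : y ≠ 0 := norm_pos_iff.mp ((norm_nonneg p).trans_lt hy)
  -- The three-term relation with third variable v, divided by v and rewritten in ε.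
  have key : ∀ ε : ℂ, (koebeProd x p ε * koebeProd (p / x) p ε -
      koebeProd y p ε * koebeProd (p / y) p ε) * (thetaProd x p ^ 2 * thetaProd y p ^ 2) =
      ε * (koebeProd p p ε) ^ 2 *
        (y * qPoch p p ^ 4 * (thetaProd (x * y) p * thetaProd (x / y) p)) := by
    intro ε
    obtain ⟨v, hv, rfl⟩ := exists_sub_one_sq_div ε
    have h1 := thetaProd_three_term hx0 hy0 hv hp hp1
    have h2 := thetaProd_mul_thetaProd_div hx hx1 hx' hp1 hv
    have h3 := thetaProd_mul_thetaProd_div hy hy1 hy' hp1 hv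
    have h4 := thetaProd_sq hp1 hv
    have h5 := thetaProd_inv (div_ne_zero hx0 hv) hp1
    rw [inv_div] at h5
    rw [h5, h4, mul_comm v x] at h1
    set ε := (v - 1) ^ 2 / v with hε
    have h6 : (v - 1) ^ 2 = ε * v := by rw [hε, div_mul_cancel₀ _ hv]
    rw [h6] at h1
    apply mul_left_cancel₀ hv
    have h7 : x * (v / x) = v := by field_simp
    linear_combination -h1 - v * thetaProd y p ^ 2 * h2 + v * thetaProd x p ^ 2 * h3 -
      thetaProd (x * v) p * thetaProd (x / v) p * thetaProd y p ^ 2 * h7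
  -- Comparing derivatives at ε = 0, where every `koebeProd` equals 1. The right side has the factor
  -- ε, so only its cofactor at 0 survives.
  have d := fun a => hasDerivAt_koebeProd a hp1
  have dl := (((d x).mul (d (p / x))).sub ((d y).mul (d (p / y)))).mul_const
    (thetaProd x p ^ 2 * thetaProd y p ^ 2)
  have dr := ((hasDerivAt_id (0 : ℂ)).mul ((d p).pow 2)).mul_const
    (y * qPoch p p ^ 4 * (thetaProd (x * y) p * thetaProd (x / y) p))
  have := dl.unique (dr.congr_of_eventuallyEq (Eventually.of_forall key))
  simp only [koebeProd_zero, Pi.pow_apply, id, one_mul, zero_mul, add_zero, one_pow, mul_one]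
    at this
  rw [koebeSum, koebeSum]
  linear_combination this

/-! ### Dissection of products, fifth roots of unity -/

lemma norm_pow_lt_one {p : ℂ} (hp1 : ‖p‖ < 1) {k : ℕ} (hk : k ≠ 0) : ‖p ^ k‖ < 1 := by
  rw [norm_pow]
  exact pow_lt_one₀ (norm_nonneg p) hp1 hk

lemma qPoch_eq_prod_residues {p : ℂ} (hp1 : ‖p‖ < 1) (a : ℂ) {k : ℕ} (hk : k ≠ 0) :
    qPoch a p = ∏ r ∈ Finset.range k, qPoch (a * p ^ r) (p ^ k) := by
  have h1 := (tendsto_prod_qPoch hp1 a).comp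
    (tendsto_id.const_mul_atTop' (Nat.pos_of_ne_zero hk))
  have h2 := tendsto_finsetProd (Finset.range k) fun r _ =>
    tendsto_prod_qPoch (norm_pow_lt_one hp1 hk) (a * p ^ r)
  refine tendsto_nhds_unique h1 (h2.congr fun N => ?_)
  simp only [Function.comp, id]
  induction N with
  | zero => simp
  | succ N ih =>
    rw [mul_add_one, Finset.prod_range_add, ← ih, ← Finset.prod_mul_distrib]
    refine Finset.prod_congr rfl fun r _ => ?_
    rw [Finset.prod_range_succ]
    ring

lemma qPoch_mul_neg {p : ℂ} (hp1 : ‖p‖ < 1) (a : ℂ) :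
    qPoch a p * qPoch (-a) p = qPoch (a ^ 2) (p ^ 2) := by
  rw [qPoch, qPoch, qPoch, ← (multipliable_one_sub_mul_pow hp1 _).tprod_mul
    (multipliable_one_sub_mul_pow hp1 _)]
  exact tprod_congr fun n => by ring

lemma fifth_root_pow_five {ζ : ℂ} (hζ : 1 + ζ + ζ ^ 2 + ζ ^ 3 + ζ ^ 4 = 0) : ζ ^ 5 = 1 := by
  linear_combination (ζ - 1) * hζ

lemma fifth_root_ne_zero {ζ : ℂ} (hζ : 1 + ζ + ζ ^ 2 + ζ ^ 3 + ζ ^ 4 = 0) : ζ ≠ 0 := by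
  rintro rfl
  simp at hζ

lemma norm_fifth_root {ζ : ℂ} (hζ : 1 + ζ + ζ ^ 2 + ζ ^ 3 + ζ ^ 4 = 0) : ‖ζ‖ = 1 := by
  have h := congrArg norm (fifth_root_pow_five hζ)
  rw [norm_pow, norm_one] at h
  exact (pow_eq_one_iff_of_nonneg (norm_nonneg ζ) (by norm_num)).mp h

lemma gauss_sum_sq {ζ : ℂ} (hζ : 1 + ζ + ζ ^ 2 + ζ ^ 3 + ζ ^ 4 = 0) :
    (ζ - ζ ^ 2 - ζ ^ 3 + ζ ^ 4) ^ 2 = 5 := by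
  linear_combination (ζ ^ 4 - 3 * ζ ^ 3 + ζ ^ 2 + 5 * ζ - 5) * hζ

lemma prod_one_sub_fifth_root {ζ : ℂ} (hζ : 1 + ζ + ζ ^ 2 + ζ ^ 3 + ζ ^ 4 = 0)
    (t : ℂ) :
    (1 - t) * (1 - ζ * t) * (1 - ζ ^ 2 * t) * (1 - ζ ^ 3 * t) * (1 - ζ ^ 4 * t) = 1 - t ^ 5 := by
  have h5 := fifth_root_pow_five hζ
  have h1 : (1 - ζ * t) * (1 - ζ ^ 4 * t) = 1 - (ζ + ζ ^ 4) * t + t ^ 2 := by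
    linear_combination t ^ 2 * h5
  have h2 : (1 - ζ ^ 2 * t) * (1 - ζ ^ 3 * t) = 1 + (1 + ζ + ζ ^ 4) * t + t ^ 2 := by
    linear_combination t ^ 2 * h5 - t * hζ
  have h3 : (ζ + ζ ^ 4) * (1 + ζ + ζ ^ 4) = 1 := by
    linear_combination hζ + (ζ ^ 3 + 2) * h5
  have h4 : (1 - t) * (1 - ζ * t) * (1 - ζ ^ 2 * t) * (1 - ζ ^ 3 * t) * (1 - ζ ^ 4 * t) =
    (1 - t) * ((1 - ζ * t) * (1 - ζ ^ 4 * t)) * ((1 - ζ ^ 2 * t) * (1 - ζ ^ 3 * t)) := by ring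
  rw [h4, h1, h2]
  linear_combination -(1 - t) * t ^ 2 * h3

lemma prod_qPoch_fifth_root {ζ : ℂ} (hζ : 1 + ζ + ζ ^ 2 + ζ ^ 3 + ζ ^ 4 = 0)
    {p : ℂ} (hp1 : ‖p‖ < 1) (a : ℂ) :
    qPoch a p * qPoch (ζ * a) p * qPoch (ζ ^ 2 * a) p * qPoch (ζ ^ 3 * a) p *
      qPoch (ζ ^ 4 * a) p = qPoch (a ^ 5) (p ^ 5) := by
  have m := multipliable_one_sub_mul_pow hp1
  simp only [qPoch]
  rw [← (m _).tprod_mul (m _), ← ((m _).mul (m _)).tprod_mul (m _),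
    ← (((m _).mul (m _)).mul (m _)).tprod_mul (m _),
    ← ((((m _).mul (m _)).mul (m _)).mul (m _)).tprod_mul (m _)]
  refine tprod_congr fun n => ?_
  have := prod_one_sub_fifth_root hζ (a * p ^ n)
  rw [show a ^ 5 * (p ^ 5) ^ n = (a * p ^ n) ^ 5 by ring, ← this]
  ring

/-! ### Eta quotients for φ and ψ, and two relations between them -/

/-- Euler's product `(q; q)_∞`. -/
noncomputable def eulerProd (q : ℂ) : ℂ := qPoch q q

lemma eulerProd_ne_zero {q : ℂ} (hq : ‖q‖ < 1) : eulerProd q ≠ 0 :=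
  qPoch_ne_zero_of_norm_lt_one hq hq

lemma qPoch_sq_mul_eulerProd {q : ℂ} (hq : ‖q‖ < 1) :
    qPoch q (q ^ 2) * eulerProd (q ^ 2) = eulerProd q := by
  rw [eulerProd, eulerProd, qPoch_eq_prod_residues hq q two_ne_zero]
  simp [Finset.prod_range_succ, sq]

lemma qPoch_neg_mul_eulerProd {q : ℂ} (hq : ‖q‖ < 1) :
    qPoch (-q) q * eulerProd q = eulerProd (q ^ 2) := by
  rw [eulerProd, eulerProd, ← qPoch_mul_neg hq, mul_comm]

lemma ramanujanThetaTerm_neg_self {q : ℂ} (hq : q ≠ 0) (n : ℤ) :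
    ramanujanThetaTerm (-q) (-q) n = thetaTerm q (q ^ 2) n := by
  have h := triangle_succ n
  rw [add_sub_cancel_right, mul_comm] at h
  rw [ramanujanThetaTerm, thetaTerm, h, zpow_add₀ (neg_ne_zero.mpr hq), ← neg_sq, ← zpow_natCast,
    ← zpow_mul, mul_comm ((2 : ℕ) : ℤ), zpow_mul, zpow_natCast]
  ring

lemma ramanujanThetaTerm_cube {q : ℂ} (hq : q ≠ 0) (n : ℤ) :
    ramanujanThetaTerm q (q ^ 3) n = thetaTerm (-q) (q ^ 4) n := by
  have h := triangle_succ n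
  rw [add_sub_cancel_right, mul_comm] at h
  rw [ramanujanThetaTerm, thetaTerm, h, zpow_add₀ hq, neg_neg, pow_succ' q 3, mul_zpow]
  ring

lemma ramanujanPhi_neg_mul_eulerProd {q : ℂ} (hq : q ≠ 0) (hq1 : ‖q‖ < 1) :
    ramanujanPhi (-q) * eulerProd (q ^ 2) = eulerProd q ^ 2 := by
  rw [ramanujanPhi, ramanujanTheta, tsum_congr (ramanujanThetaTerm_neg_self hq),
    tsum_thetaTerm hq (pow_ne_zero 2 hq) (norm_pow_lt_one hq1 two_ne_zero), thetaProd,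
    show q ^ 2 / q = q by field_simp, ← qPoch_sq_mul_eulerProd hq1, eulerProd]
  ring

/-- Triple product with nome q^4 at -q; (-q; q^4)(-q³; q^4) = (-q; q²), which is then removed using
(-q; q)_∞ = E_2/E_1. -/
lemma ramanujanPsi_mul_eulerProd {q : ℂ} (hq : q ≠ 0) (hq1 : ‖q‖ < 1) :
    ramanujanPsi q * eulerProd q = eulerProd (q ^ 2) ^ 2 := by
  have hq2 := norm_pow_lt_one hq1 two_ne_zero
  have h1 : qPoch (-q) (q ^ 2) = qPoch (-q) (q ^ 4) * qPoch (-q ^ 3) (q ^ 4) := by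
    rw [qPoch_eq_prod_residues hq2 _ two_ne_zero, Finset.prod_range_succ, Finset.prod_range_one]
    congr 2 <;> ring
  have h2 : qPoch (-q) q = qPoch (-q) (q ^ 2) * qPoch (-q ^ 2) (q ^ 2) := by
    rw [qPoch_eq_prod_residues hq1 _ two_ne_zero, Finset.prod_range_succ, Finset.prod_range_one]
    congr 2 <;> ring
  have h3 := qPoch_neg_mul_eulerProd hq1
  have h4 := qPoch_neg_mul_eulerProd hq2
  have h5 : qPoch (q ^ 4) (q ^ 4) = eulerProd ((q ^ 2) ^ 2) := by rw [eulerProd, ← pow_mul]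
  rw [ramanujanPsi, ramanujanTheta, tsum_congr (ramanujanThetaTerm_cube hq),
    tsum_thetaTerm (neg_ne_zero.mpr hq) (pow_ne_zero 4 hq) (norm_pow_lt_one hq1 four_ne_zero),
    thetaProd, show q ^ 4 / -q = -q ^ 3 by field_simp, ← h1, h5]
  linear_combination -qPoch (-q) (q ^ 2) * eulerProd q * h4 + eulerProd (q ^ 2) * h3 -
    eulerProd (q ^ 2) * eulerProd q * h2

lemma thetaProd_pow_ten {q : ℂ} (hq : q ≠ 0) {k : ℕ} (hk : k ≤ 10) :
    thetaProd (q ^ k) (q ^ 10) = qPoch (q ^ k) (q ^ 10) * qPoch (q ^ (10 - k)) (q ^ 10) := by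
  rw [thetaProd, pow_sub₀ q hq hk, div_eq_mul_inv]

/-- Residues r and 10 - r modulo 10 pair into theta products; the residues 0 and 5 make up
`eulerProd (q ^ 5)`. -/
lemma eulerProd_eq_thetaProd_ten {q : ℂ} (hq : q ≠ 0) (hq1 : ‖q‖ < 1) :
    eulerProd q =
    thetaProd q (q ^ 10) * thetaProd (q ^ 2) (q ^ 10) * thetaProd (q ^ 3) (q ^ 10) *
      thetaProd (q ^ 4) (q ^ 10) * eulerProd (q ^ 5) := by
  have h1 := thetaProd_pow_ten hq (k := 1) (by norm_num)
  rw [pow_one] at h1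
  have h5 : eulerProd (q ^ 5) = qPoch (q ^ 5) (q ^ 10) * qPoch (q ^ 10) (q ^ 10) := by
    rw [eulerProd, qPoch_eq_prod_residues (norm_pow_lt_one hq1 (by norm_num)) _ two_ne_zero]
    simp only [Finset.prod_range_succ, Finset.prod_range_zero, one_mul, mul_one,
      ← pow_mul, ← pow_add]
  rw [h1, h5, thetaProd_pow_ten hq (by norm_num), thetaProd_pow_ten hq (by norm_num),
    thetaProd_pow_ten hq (by norm_num), eulerProd,
    qPoch_eq_prod_residues hq1 _ (show 10 ≠ 0 by norm_num)]
  simp only [Finset.prod_range_succ, Finset.prod_range_zero, one_mul,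
      ← pow_succ']
  norm_num
  ring

lemma eulerProd_sq_eq_thetaProd_ten {q : ℂ} (hq : q ≠ 0) (hq1 : ‖q‖ < 1) :
    eulerProd (q ^ 2) =
    thetaProd (q ^ 2) (q ^ 10) * thetaProd (q ^ 4) (q ^ 10) * eulerProd (q ^ 10) := by
  rw [thetaProd_pow_ten hq (by norm_num), thetaProd_pow_ten hq (by norm_num), eulerProd,
    eulerProd,
    qPoch_eq_prod_residues (norm_pow_lt_one hq1 two_ne_zero) _ (show 5 ≠ 0 by norm_num)]
  simp only [Finset.prod_range_succ, Finset.prod_range_zero, one_mul, mul_one,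
      ← pow_mul, ← pow_add]
  ring

lemma thetaProd_five_ten {q : ℂ} (hq : q ≠ 0) (hq1 : ‖q‖ < 1) :
    thetaProd (q ^ 5) (q ^ 10) * eulerProd (q ^ 10) ^ 2 = eulerProd (q ^ 5) ^ 2 := by
  have := qPoch_sq_mul_eulerProd (norm_pow_lt_one hq1 (show 5 ≠ 0 by norm_num))
  rw [← pow_mul] at this
  rw [thetaProd_pow_ten hq (by norm_num), ← this]
  ring

/-- The eta-quotient form of `ψ(q)² - q ψ(q⁵)² = f(q, q⁴) f(q², q³)`. -/
theorem eulerProd_identity_one {q : ℂ} (hq : q ≠ 0) (hq1 : ‖q‖ < 1) :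
    eulerProd (q ^ 2) ^ 4 * eulerProd (q ^ 5) ^ 2 * eulerProd (q ^ 10) -
      q * eulerProd (q ^ 10) ^ 5 * eulerProd q ^ 2 =
    eulerProd q * eulerProd (q ^ 2) * eulerProd (q ^ 5) ^ 5 := by
  have hp : q ^ 10 ≠ 0 := pow_ne_zero _ hq
  have hp1 := norm_pow_lt_one hq1 (show 10 ≠ 0 by norm_num)
  -- With exponents 3, 5, 4 the sums and differences are 8, -2, 9, 1, 7, 1, so reflection k ↦ 10 - k
  -- and inversion leave only θ(q), …, θ(q^5).
  have h := thetaProd_three_term (pow_ne_zero 3 hq) (pow_ne_zero 5 hq) (pow_ne_zero 4 hq) hp hp1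
  have r : ∀ k : ℕ, k ≤ 10 → thetaProd (q ^ (10 - k)) (q ^ 10) = thetaProd (q ^ k) (q ^ 10) := by
    intro k hk
    rw [← thetaProd_div (x := q ^ k) hp, pow_sub₀ q hq hk, div_eq_mul_inv]
  have e8 := r 2 (by norm_num)
  have e9 := r 1 (by norm_num)
  have e7 := r 3 (by norm_num)
  norm_num at e7 e8 e9
  have i2 := thetaProd_inv (p := q ^ 10) (pow_ne_zero 2 hq) hp1
  rw [show q ^ 3 * q ^ 5 = q ^ 8 by ring, show q ^ 3 / q ^ 5 = (q ^ 2)⁻¹ by field_simp,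
    show q ^ 5 * q ^ 4 = q ^ 9 by ring, show q ^ 5 / q ^ 4 = q by field_simp,
    show q ^ 4 * q ^ 3 = q ^ 7 by ring, show q ^ 4 / q ^ 3 = q by field_simp,
    e7, e8, e9, i2] at h
  have hM : thetaProd (q ^ 2) (q ^ 10) ^ 2 * thetaProd (q ^ 4) (q ^ 10) ^ 2 -
      q * thetaProd q (q ^ 10) ^ 2 * thetaProd (q ^ 3) (q ^ 10) ^ 2 =
      thetaProd q (q ^ 10) * thetaProd (q ^ 3) (q ^ 10) * thetaProd (q ^ 5) (q ^ 10) ^ 2 := by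
    apply mul_left_cancel₀ (pow_ne_zero 3 hq)
    have hc : q ^ 5 * (q ^ 2)⁻¹ = q ^ 3 := by field_simp
    linear_combination -h - thetaProd (q ^ 2) (q ^ 10) ^ 2 * thetaProd (q ^ 4) (q ^ 10) ^ 2 * hc
  have t := thetaProd_five_ten hq hq1
  rw [eulerProd_eq_thetaProd_ten hq hq1, eulerProd_sq_eq_thetaProd_ten hq hq1]
  generalize thetaProd q (q ^ 10) = a at *
  generalize thetaProd (q ^ 2) (q ^ 10) = b at *
  generalize thetaProd (q ^ 3) (q ^ 10) = c at *
  generalize thetaProd (q ^ 4) (q ^ 10) = d at *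
  generalize thetaProd (q ^ 5) (q ^ 10) = f at *
  generalize eulerProd (q ^ 5) = e5 at *
  generalize eulerProd (q ^ 10) = e10 at *
  linear_combination b ^ 2 * d ^ 2 * e5 ^ 2 * e10 ^ 5 * hM +
    a * c * b ^ 2 * d ^ 2 * e5 ^ 2 * e10 * (f * e10 ^ 2 + e5 ^ 2) * t

/-- Since p/ζ = ζ⁴p and p/ζ² = ζ³p, the left side runs through all fifth roots of unity times p,
apart from the two leading factors 1 - ζ and 1 - ζ². -/
lemma thetaProd_fifth_root_mul {ζ : ℂ} (hζ : 1 + ζ + ζ ^ 2 + ζ ^ 3 + ζ ^ 4 = 0) {p : ℂ}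
    (hp1 : ‖p‖ < 1) :
    thetaProd ζ p * thetaProd (ζ ^ 2) p * eulerProd p =
      (1 - ζ) * (1 - ζ ^ 2) * eulerProd (p ^ 5) := by
  have h5 := fifth_root_pow_five hζ
  have h0 := fifth_root_ne_zero hζ
  have e1 : p / ζ = ζ ^ 4 * p := by rw [div_eq_iff h0]; linear_combination -p * h5
  have e2 : p / ζ ^ 2 = ζ ^ 3 * p := by
    rw [div_eq_iff (pow_ne_zero 2 h0)]; linear_combination -p * h5
  have h := prod_qPoch_fifth_root hζ hp1 p
  rw [thetaProd, thetaProd, e1, e2, qPoch_eq_one_sub_mul hp1 ζ, qPoch_eq_one_sub_mul hp1 (ζ ^ 2),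
    eulerProd, eulerProd, ← h]
  ring

lemma thetaProd_neg_fifth_root_mul {ζ : ℂ} (hζ : 1 + ζ + ζ ^ 2 + ζ ^ 3 + ζ ^ 4 = 0) {p : ℂ}
    (hp1 : ‖p‖ < 1) :
    thetaProd (-ζ) p * thetaProd (-ζ ^ 2) p * eulerProd (p ^ 2) * eulerProd (p ^ 5) =
      -ζ ^ 4 * eulerProd (p ^ 10) * eulerProd p := by
  have h5 := fifth_root_pow_five hζ
  have h0 := fifth_root_ne_zero hζ
  have e1 : p / -ζ = ζ ^ 4 * -p := by
    rw [div_eq_iff (neg_ne_zero.mpr h0)]; linear_combination -p * h5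
  have e2 : p / -ζ ^ 2 = ζ ^ 3 * -p := by
    rw [div_eq_iff (neg_ne_zero.mpr (pow_ne_zero 2 h0))]; linear_combination -p * h5
  have h := prod_qPoch_fifth_root hζ hp1 (-p)
  have h1 := qPoch_neg_mul_eulerProd hp1
  have h2 := qPoch_neg_mul_eulerProd (norm_pow_lt_one hp1 (show 5 ≠ 0 by norm_num))
  rw [← pow_mul] at h2
  norm_num at h2
  rw [show (-p) ^ 5 = -p ^ 5 by ring] at h
  rw [thetaProd, thetaProd, e1, e2, qPoch_eq_one_sub_mul hp1 (-ζ),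
    qPoch_eq_one_sub_mul hp1 (-ζ ^ 2), ← h1, ← h2, ← h,
    show -ζ * p = ζ * -p by ring, show -ζ ^ 2 * p = ζ ^ 2 * -p by ring]
  linear_combination qPoch (-p) p * qPoch (ζ * -p) p * qPoch (ζ ^ 2 * -p) p *
    qPoch (ζ ^ 3 * -p) p * qPoch (ζ ^ 4 * -p) p * eulerProd p * eulerProd (p ^ 5) * hζ

lemma thetaProd_fifth_root_mul_nome {ζ : ℂ} (hζ : 1 + ζ + ζ ^ 2 + ζ ^ 3 + ζ ^ 4 = 0) {q : ℂ}
    (hq : q ≠ 0) (hq1 : ‖q‖ < 1) :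
    thetaProd (ζ * q) (q ^ 2) * thetaProd (ζ ^ 2 * q) (q ^ 2) * eulerProd q * eulerProd (q ^ 10) =
      eulerProd (q ^ 5) * eulerProd (q ^ 2) := by
  have h5 := fifth_root_pow_five hζ
  have h0 := fifth_root_ne_zero hζ
  have e1 : q ^ 2 / (ζ * q) = ζ ^ 4 * q := by
    rw [div_eq_iff (mul_ne_zero h0 hq)]; linear_combination -q ^ 2 * h5
  have e2 : q ^ 2 / (ζ ^ 2 * q) = ζ ^ 3 * q := by
    rw [div_eq_iff (mul_ne_zero (pow_ne_zero 2 h0) hq)]; linear_combination -q ^ 2 * h5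
  have h := prod_qPoch_fifth_root hζ (norm_pow_lt_one hq1 two_ne_zero) q
  have h1 := qPoch_sq_mul_eulerProd hq1
  have h2 := qPoch_sq_mul_eulerProd (norm_pow_lt_one hq1 (show 5 ≠ 0 by norm_num))
  rw [← pow_mul, mul_comm] at h
  rw [← pow_mul] at h2
  norm_num at h2 h
  rw [thetaProd, thetaProd, e1, e2, ← h1, ← h2, ← h]
  ring

lemma thetaProd_signed_mul {s q : ℂ} (hs : s ^ 2 = 1) (hq : q ≠ 0) (hq1 : ‖q‖ < 1) :
    thetaProd (s * q) (q ^ 5) * thetaProd (s * q ^ 2) (q ^ 5) * qPoch (s * q ^ 5) (q ^ 5) =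
      qPoch (s * q) q := by
  have hs0 : s ≠ 0 := by
    rintro rfl
    norm_num at hs
  have e1 : q ^ 5 / (s * q) = s * q ^ 4 := by
    rw [div_eq_iff (mul_ne_zero hs0 hq)]; linear_combination -q ^ 5 * hs
  have e2 : q ^ 5 / (s * q ^ 2) = s * q ^ 3 := by
    rw [div_eq_iff (mul_ne_zero hs0 (pow_ne_zero 2 hq))]; linear_combination -q ^ 5 * hs
  rw [thetaProd, thetaProd, e1, e2, qPoch_eq_prod_residues hq1 (s * q) (show 5 ≠ 0 by norm_num)]
  simp only [Finset.prod_range_succ, Finset.prod_range_zero, one_mul, mul_assoc s,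
    ← pow_succ']
  ring_nf

/-- The eta-quotient form of the expansion of `ψ(q)² - 5 q ψ(q⁵)²`. -/
theorem eulerProd_identity_five {q : ℂ} (hq : q ≠ 0) (hq1 : ‖q‖ < 1) {ζ : ℂ}
    (hζ : 1 + ζ + ζ ^ 2 + ζ ^ 3 + ζ ^ 4 = 0) :
    eulerProd (q ^ 2) ^ 5 * eulerProd (q ^ 5) ^ 2 -
      5 * q * eulerProd (q ^ 10) ^ 4 * eulerProd q ^ 2 * eulerProd (q ^ 2) =
    eulerProd q ^ 5 * eulerProd (q ^ 5) * eulerProd (q ^ 10) := by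
  have h5 := fifth_root_pow_five hζ
  have h0 := fifth_root_ne_zero hζ
  have hq2 := norm_pow_lt_one hq1 two_ne_zero
  have hp : q ^ 2 ≠ 0 := pow_ne_zero 2 hq
  -- With ζ²q, q, ζ⁴ and nome q², every argument reduces by reflection, inversion and ζ⁵ = 1 to one
  -- of ζ, ζ², q, ζq, ζ²q.
  have h := thetaProd_three_term (mul_ne_zero (pow_ne_zero 2 h0) hq) hq (pow_ne_zero 4 h0) hp hq2
  have i2 := thetaProd_inv (x := ζ ^ 2) (pow_ne_zero 2 h0) hq2
  have i1 := thetaProd_inv (x := ζ) h0 hq2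
  have i3 := thetaProd_inv (x := ζ ^ 3 * q) (mul_ne_zero (pow_ne_zero 3 h0) hq) hq2
  have j1 : ζ⁻¹ = ζ ^ 4 := inv_eq_of_mul_eq_one_right (by linear_combination h5)
  have j2 : (ζ ^ 2)⁻¹ = ζ ^ 3 := inv_eq_of_mul_eq_one_right (by linear_combination h5)
  have j3 : (ζ ^ 3 * q)⁻¹ = ζ ^ 4 / (ζ ^ 2 * q) := by
    field_simp
    linear_combination -h5
  rw [j1] at i1
  rw [j2] at i2
  rw [j3] at i3
  have d1 : thetaProd (ζ ^ 4 * q) (q ^ 2) = thetaProd (ζ * q) (q ^ 2) := by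
    rw [← thetaProd_div hp]
    congr 1
    field_simp
    linear_combination -h5
  have d2 : thetaProd (ζ ^ 3 * q) (q ^ 2) = thetaProd (ζ ^ 2 * q) (q ^ 2) := by
    rw [← thetaProd_div hp]
    congr 1
    field_simp
    linear_combination -h5
  have d3 : thetaProd (ζ ^ 2 * q * q) (q ^ 2) = thetaProd (ζ ^ 3) (q ^ 2) := by
    rw [← thetaProd_div hp]
    congr 1
    field_simp
    linear_combination -h5
  rw [d3, show ζ ^ 2 * q / q = ζ ^ 2 by field_simp, mul_comm q (ζ ^ 4), d1,
    show q / ζ ^ 4 = ζ * q by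
      rw [div_eq_iff (pow_ne_zero 4 h0)]; linear_combination -q * h5,
    show ζ ^ 4 * (ζ ^ 2 * q) = ζ * q by linear_combination ζ * q * h5, i1, i2, i3, d2] at h
  have h1 := qPoch_sq_mul_eulerProd hq1
  have hs : thetaProd q (q ^ 2) * eulerProd (q ^ 2) ^ 2 = eulerProd q ^ 2 := by
    rw [thetaProd, show q ^ 2 / q = q by field_simp, ← h1]
    ring
  have hD := thetaProd_fifth_root_mul hζ hq2
  have hC := thetaProd_fifth_root_mul_nome hζ hq hq1
  have hg := gauss_sum_sq hζ
  rw [← pow_mul] at hD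
  norm_num at hD
  have hrel : (thetaProd (ζ * q) (q ^ 2) * thetaProd (ζ ^ 2 * q) (q ^ 2)) ^ 2 -
      thetaProd (ζ * q) (q ^ 2) * thetaProd (ζ ^ 2 * q) (q ^ 2) * thetaProd q (q ^ 2) ^ 2 =
      q * ζ ^ 2 * (thetaProd ζ (q ^ 2) * thetaProd (ζ ^ 2) (q ^ 2)) ^ 2 := by
    apply mul_left_cancel₀ (pow_ne_zero 4 h0)
    have hc : ζ ^ 2 * q * (ζ ^ 4 / (ζ ^ 2 * q)) = ζ ^ 4 := by field_simp
    generalize ζ ^ 4 / (ζ ^ 2 * q) = w at *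
    generalize thetaProd (ζ * q) (q ^ 2) = a at *
    generalize thetaProd (ζ ^ 2 * q) (q ^ 2) = b at *
    generalize thetaProd q (q ^ 2) = c at *
    generalize thetaProd ζ (q ^ 2) = d at *
    generalize thetaProd (ζ ^ 2) (q ^ 2) = e at *
    linear_combination h + a * b * c ^ 2 * hc + q * ζ ^ 6 * d ^ 2 * e ^ 2 * h5
  -- The constant ζ(1 - ζ)(1 - ζ²) is the Gauss sum; its square is the 5 of the identity.
  have hk : (ζ * ((1 - ζ) * (1 - ζ ^ 2))) ^ 2 = 5 := by
    rw [← hg]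
    ring
  have hE2 := eulerProd_ne_zero hq2
  apply mul_right_cancel₀ hE2
  generalize thetaProd (ζ * q) (q ^ 2) * thetaProd (ζ ^ 2 * q) (q ^ 2) = C at *
  generalize thetaProd q (q ^ 2) = c at *
  generalize thetaProd ζ (q ^ 2) * thetaProd (ζ ^ 2) (q ^ 2) = D at *
  generalize (1 - ζ) * (1 - ζ ^ 2) = κ at *
  generalize eulerProd (q ^ 2) = e2 at *
  generalize eulerProd (q ^ 5) = e5 at *
  generalize eulerProd (q ^ 10) = e10 at *
  generalize eulerProd q = e1 at *
  linear_combination e1 ^ 2 * e10 ^ 2 * e2 ^ 4 * hrel -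
    e2 ^ 4 * (C * e1 * e10 + e5 * e2) * hC + e10 * e1 ^ 5 * hC +
    C * e1 ^ 2 * e10 ^ 2 * (c * e2 ^ 2 + e1 ^ 2) * hs +
    q * ζ ^ 2 * e1 ^ 2 * e10 ^ 2 * e2 ^ 2 * (D * e2 + κ * e10) * hD +
    q * e1 ^ 2 * e10 ^ 4 * e2 ^ 2 * hk

/-! ### The four ℘-differences as eta quotients -/

lemma koebeSum_sub_ten {q : ℂ} (hq : q ≠ 0) (hq1 : ‖q‖ < 1) :
    (koebeSum q (q ^ 10) - koebeSum (q ^ 3) (q ^ 10)) * eulerProd q ^ 2 =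
      q * eulerProd (q ^ 2) ^ 3 * eulerProd (q ^ 5) ^ 2 * eulerProd (q ^ 10) := by
  have hn : 0 < ‖q‖ := norm_pos_iff.mpr hq
  have n1 : q ≠ 1 := by
    rintro rfl
    simp at hq1
  have n3 : q ^ 3 ≠ 1 := fun h => by simpa [h] using norm_pow_lt_one hq1 three_ne_zero
  have hlt : ∀ {m n : ℕ}, n < m → ‖q ^ m‖ < ‖q ^ n‖ := fun h => by
    rw [norm_pow, norm_pow]
    exact pow_lt_pow_right_of_lt_one₀ hn hq1 h
  have h := koebeSum_sub (x := q ^ 3) (y := q) (p := q ^ 10) (hlt (by norm_num))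
    (norm_pow_lt_one hq1 three_ne_zero).le n3 (by simpa using hlt (show 1 < 10 by norm_num))
    hq1.le n1 (pow_ne_zero _ hq) (norm_pow_lt_one hq1 (by norm_num))
  rw [show q ^ 3 * q = q ^ 4 by ring, show q ^ 3 / q = q ^ 2 by field_simp] at h
  rw [eulerProd_eq_thetaProd_ten hq hq1, eulerProd_sq_eq_thetaProd_ten hq hq1]
  rw [← eulerProd] at h
  linear_combination thetaProd (q ^ 2) (q ^ 10) ^ 2 * thetaProd (q ^ 4) (q ^ 10) ^ 2 *
    eulerProd (q ^ 5) ^ 2 * h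

lemma koebeSum_sub_fifth_root_two {ζ : ℂ} (hζ : 1 + ζ + ζ ^ 2 + ζ ^ 3 + ζ ^ 4 = 0) {q : ℂ}
    (hq : q ≠ 0) (hq1 : ‖q‖ < 1) :
    (koebeSum (ζ * q) (q ^ 2) - koebeSum (ζ ^ 2 * q) (q ^ 2)) * eulerProd (q ^ 5) ^ 2 =
      (ζ - ζ ^ 2 - ζ ^ 3 + ζ ^ 4) *
        (q * eulerProd q ^ 2 * eulerProd (q ^ 2) * eulerProd (q ^ 10) ^ 3) := by
  have h5 := fifth_root_pow_five hζ
  have h0 := fifth_root_ne_zero hζ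
  have hq2 := norm_pow_lt_one hq1 two_ne_zero
  have hn : ‖ζ‖ = 1 := norm_fifth_root hζ
  have hlt : ‖q ^ 2‖ < ‖q‖ := by
    rw [norm_pow]
    exact pow_lt_self_of_lt_one₀ (norm_pos_iff.mpr hq) hq1 one_lt_two
  have n1 : ‖ζ * q‖ = ‖q‖ := by rw [norm_mul, hn, one_mul]
  have n2 : ‖ζ ^ 2 * q‖ = ‖q‖ := by rw [norm_mul, norm_pow, hn, one_pow, one_mul]
  have hne : ∀ {z : ℂ}, ‖z‖ = ‖q‖ → z ≠ 1 := by
    rintro z hz rfl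
    rw [norm_one] at hz
    exact hq1.ne' hz
  have h := koebeSum_sub (n2 ▸ hlt) (n2 ▸ hq1.le) (hne n2) (n1 ▸ hlt) (n1 ▸ hq1.le) (hne n1)
    (pow_ne_zero 2 hq) hq2
  have e3 : ζ ^ 2 * q * (ζ * q) = q ^ 2 / ζ ^ 2 := by
    rw [eq_div_iff (pow_ne_zero 2 h0)]; linear_combination q ^ 2 * h5
  rw [e3, thetaProd_div (pow_ne_zero 2 hq), show ζ ^ 2 * q / (ζ * q) = ζ by field_simp,
    ← eulerProd] at h
  have hD := thetaProd_fifth_root_mul hζ hq2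
  have hC := thetaProd_fifth_root_mul_nome hζ hq hq1
  rw [← pow_mul] at hD
  norm_num at hD
  apply mul_right_cancel₀ (pow_ne_zero 2 (eulerProd_ne_zero hq2))
  generalize koebeSum (ζ * q) (q ^ 2) - koebeSum (ζ ^ 2 * q) (q ^ 2) = K at *
  generalize thetaProd (ζ * q) (q ^ 2) = a at *
  generalize thetaProd (ζ ^ 2 * q) (q ^ 2) = b at *
  linear_combination eulerProd q ^ 2 * eulerProd (q ^ 10) ^ 2 * h -
    K * (a * b * eulerProd q * eulerProd (q ^ 10) + eulerProd (q ^ 5) * eulerProd (q ^ 2)) * hC +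
    ζ * q * eulerProd (q ^ 2) ^ 3 * eulerProd q ^ 2 * eulerProd (q ^ 10) ^ 2 * hD

lemma koebeSum_sub_five {q : ℂ} (hq : q ≠ 0) (hq1 : ‖q‖ < 1) :
    (koebeSum (-q) (q ^ 5) - koebeSum (-q ^ 2) (q ^ 5)) * eulerProd (q ^ 2) ^ 2 =
      -(q * eulerProd q ^ 3 * eulerProd (q ^ 5) * eulerProd (q ^ 10) ^ 2) := by
  have hq5 := norm_pow_lt_one hq1 (show 5 ≠ 0 by norm_num)
  have hq2 := norm_pow_lt_one hq1 two_ne_zero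
  have hn : 0 < ‖q‖ := norm_pos_iff.mpr hq
  have n1 : ‖-q‖ = ‖q‖ := norm_neg q
  have n2 : ‖-q ^ 2‖ = ‖q ^ 2‖ := norm_neg _
  have l1 : ‖q ^ 5‖ < ‖q‖ := by
    rw [norm_pow]
    exact pow_lt_self_of_lt_one₀ hn hq1 (by norm_num)
  have l2 : ‖q ^ 5‖ < ‖q ^ 2‖ := by
    rw [norm_pow, norm_pow]
    exact pow_lt_pow_right_of_lt_one₀ hn hq1 (by norm_num)
  have hne : ∀ {z : ℂ}, ‖z‖ < 1 → z ≠ 1 := by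
    rintro z hz rfl
    simp at hz
  have h := koebeSum_sub (n2 ▸ l2) (n2 ▸ hq2.le) (hne (n2 ▸ hq2)) (n1 ▸ l1) (n1 ▸ hq1.le)
    (hne (n1 ▸ hq1)) (pow_ne_zero 5 hq) hq5
  rw [show -q ^ 2 * -q = q ^ 5 / q ^ 2 by field_simp, thetaProd_div (pow_ne_zero 5 hq),
    show -q ^ 2 / -q = q by field_simp, ← eulerProd] at h
  have s1 := thetaProd_signed_mul (s := 1) (by norm_num) hq hq1
  have s2 := thetaProd_signed_mul (s := -1) (by norm_num) hq hq1
  simp only [one_mul, neg_mul] at s1 s2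
  rw [← eulerProd, ← eulerProd] at s1
  have t1 := qPoch_neg_mul_eulerProd hq1
  have t2 := qPoch_neg_mul_eulerProd hq5
  rw [← pow_mul] at t2
  norm_num at t2
  have hT : thetaProd (-q) (q ^ 5) * thetaProd (-q ^ 2) (q ^ 5) * eulerProd (q ^ 10) *
      eulerProd q = eulerProd (q ^ 2) * eulerProd (q ^ 5) := by
    rw [← t1, ← t2, ← s2]
    ring
  apply mul_right_cancel₀ (pow_ne_zero 2 (eulerProd_ne_zero hq5))
  generalize koebeSum (-q) (q ^ 5) - koebeSum (-q ^ 2) (q ^ 5) = K at *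
  generalize thetaProd (-q) (q ^ 5) = a at *
  generalize thetaProd (-q ^ 2) (q ^ 5) = b at *
  linear_combination eulerProd q ^ 2 * eulerProd (q ^ 10) ^ 2 * h -
    K * (a * b * eulerProd (q ^ 10) * eulerProd q + eulerProd (q ^ 2) * eulerProd (q ^ 5)) * hT -
    q * eulerProd (q ^ 5) ^ 3 * eulerProd (q ^ 10) ^ 2 * eulerProd q ^ 2 * s1

lemma koebeSum_sub_fifth_root_one {ζ : ℂ} (hζ : 1 + ζ + ζ ^ 2 + ζ ^ 3 + ζ ^ 4 = 0) {q : ℂ}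
    (hq : q ≠ 0) (hq1 : ‖q‖ < 1) :
    (koebeSum (-ζ) q - koebeSum (-ζ ^ 2) q) * eulerProd (q ^ 10) ^ 2 =
      (ζ - ζ ^ 2 - ζ ^ 3 + ζ ^ 4) *
        (eulerProd q * eulerProd (q ^ 2) ^ 2 * eulerProd (q ^ 5) ^ 3) := by
  have h5 := fifth_root_pow_five hζ
  have h0 := fifth_root_ne_zero hζ
  have hn : ‖ζ‖ = 1 := norm_fifth_root hζ
  have n1 : ‖-ζ‖ = 1 := by rw [norm_neg, hn]
  have n2 : ‖-ζ ^ 2‖ = 1 := by rw [norm_neg, norm_pow, hn, one_pow]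
  have m1 : -ζ ≠ 1 := by
    intro h
    have : ζ = -1 := by linear_combination -h
    rw [this] at hζ
    norm_num at hζ
  have m2 : -ζ ^ 2 ≠ 1 := by
    intro h
    apply one_ne_zero (α := ℂ)
    linear_combination hζ + (ζ + ζ ^ 2) * h
  have h := koebeSum_sub (n2.symm ▸ hq1) n2.le m2 (n1.symm ▸ hq1) n1.le m1 hq hq1
  have i2 := thetaProd_inv (x := ζ ^ 2) (pow_ne_zero 2 h0) hq1
  have j2 : (ζ ^ 2)⁻¹ = ζ ^ 3 := inv_eq_of_mul_eq_one_right (by linear_combination h5)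
  rw [show -ζ ^ 2 * -ζ = ζ ^ 3 by ring, show -ζ ^ 2 / -ζ = ζ by field_simp, ← j2, i2, j2,
    ← eulerProd] at h
  have hD := thetaProd_fifth_root_mul hζ hq1
  have hT := thetaProd_neg_fifth_root_mul hζ hq1
  apply mul_right_cancel₀ (pow_ne_zero 2 (eulerProd_ne_zero hq1))
  -- `hT` is used squared, and its constant -ζ⁴ then contributes ζ⁸.
  apply mul_left_cancel₀ (pow_ne_zero 8 h0)
  generalize koebeSum (-ζ) q - koebeSum (-ζ ^ 2) q = K at *
  generalize thetaProd (-ζ) q = a at *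
  generalize thetaProd (-ζ ^ 2) q = b at *
  have h13 : ζ ^ 4 * (1 - ζ) * (1 - ζ ^ 2) = ζ ^ 8 * (ζ - ζ ^ 2 - ζ ^ 3 + ζ ^ 4) := by
    linear_combination -(ζ ^ 4 * (1 - ζ) * (1 - ζ ^ 2)) * h5
  linear_combination eulerProd (q ^ 2) ^ 2 * eulerProd (q ^ 5) ^ 2 * h -
    K * (a * b * eulerProd (q ^ 2) * eulerProd (q ^ 5) - ζ ^ 4 * eulerProd (q ^ 10) *
      eulerProd q) * hT + ζ ^ 4 * eulerProd q ^ 3 * eulerProd (q ^ 2) ^ 2 *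
      eulerProd (q ^ 5) ^ 2 * hD +
    eulerProd q ^ 3 * eulerProd (q ^ 2) ^ 2 * eulerProd (q ^ 5) ^ 3 * h13

/-! ### The Legendre symbol and Lambert series -/

lemma legendreFive_add_five_mul (m r : ℕ) : legendreFive (5 * m + r) = legendreFive r := by
  have h : ((5 * m + r : ℕ) : ℤ) % ((5 : ℕ) : ℤ) = (r : ℤ) % ((5 : ℕ) : ℤ) := by
    push_cast
    lia
  rw [legendreFive, legendreFive, legendreSym.mod, h, ← legendreSym.mod]

lemma legendreFive_zero : legendreFive 0 = 0 := by simp [legendreFive, legendreSym]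
lemma legendreFive_one : legendreFive 1 = 1 := by simp [legendreFive]
lemma legendreFive_two : legendreFive 2 = -1 := by
  rw [legendreFive, show legendreSym 5 ((2 : ℕ) : ℤ) = -1 by decide]; norm_num
lemma legendreFive_three : legendreFive 3 = -1 := by
  rw [legendreFive, show legendreSym 5 ((3 : ℕ) : ℤ) = -1 by decide]; norm_num
lemma legendreFive_four : legendreFive 4 = 1 := by
  rw [legendreFive, show legendreSym 5 ((4 : ℕ) : ℤ) = 1 by decide]; norm_num

lemma exists_eq_five_mul_add (n : ℕ) : ∃ m r : ℕ, n = 5 * m + r ∧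
    (r = 0 ∨ r = 1 ∨ r = 2 ∨ r = 3 ∨ r = 4) :=
  ⟨n / 5, n % 5, by lia, by lia⟩

lemma norm_legendreFive_le (n : ℕ) : ‖legendreFive n‖ ≤ 1 := by
  obtain ⟨m, r, rfl, h⟩ := exists_eq_five_mul_add n
  rw [legendreFive_add_five_mul]
  rcases h with rfl | rfl | rfl | rfl | rfl <;>
    simp [legendreFive_zero, legendreFive_one, legendreFive_two, legendreFive_three,
      legendreFive_four]

lemma legendreFive_mul_gauss_sum {ζ : ℂ} (hζ : 1 + ζ + ζ ^ 2 + ζ ^ 3 + ζ ^ 4 = 0) (n : ℕ) :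
    legendreFive n * (ζ - ζ ^ 2 - ζ ^ 3 + ζ ^ 4) =
      ζ ^ n - (ζ ^ 2) ^ n - (ζ ^ 3) ^ n + (ζ ^ 4) ^ n := by
  have h5 := fifth_root_pow_five hζ
  obtain ⟨m, r, rfl, h⟩ := exists_eq_five_mul_add n
  have hr : ∀ k : ℕ, (ζ ^ k) ^ (5 * m + r) = (ζ ^ k) ^ r := fun k => by
    rw [pow_add, pow_mul, ← pow_mul ζ, mul_comm k, pow_mul, h5, one_pow, one_pow, one_mul]
  have h1 := hr 1
  rw [pow_one] at h1
  rw [legendreFive_add_five_mul, hr, hr, hr, h1]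
  rcases h with rfl | rfl | rfl | rfl | rfl
  · simp [legendreFive_zero]
  · simp [legendreFive_one]
  · rw [legendreFive_two]
    linear_combination (ζ - ζ ^ 3) * h5
  · rw [legendreFive_three]
    linear_combination (ζ + ζ ^ 4 - ζ ^ 2 * (ζ ^ 5 + 1)) * h5
  · rw [legendreFive_four]
    linear_combination (ζ ^ 3 + ζ ^ 2 * (ζ ^ 5 + 1) - ζ * (ζ ^ 10 + ζ ^ 5 + 1)) * h5

lemma norm_pow_le_norm_pow_of_le {b : ℂ} (hb : ‖b‖ < 1) {m k : ℕ} (h : m ≤ k) :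
    ‖b ^ k‖ ≤ ‖b‖ ^ m := by
  rw [norm_pow]
  exact pow_le_pow_of_le_one (norm_nonneg b) hb.le h

lemma summable_lambert_double {w b : ℂ} (hw : ‖w‖ < 1) (hb : ‖b‖ < 1) :
    Summable fun z : ℕ × ℕ => (z.1 : ℂ) * (w * b ^ z.2) ^ z.1 := by
  have h1 : Summable fun n : ℕ => (n : ℝ) * ‖w‖ ^ n :=
    (hasSum_coe_mul_geometric_of_norm_lt_one (r := ‖w‖) (by simpa using hw)).summable
  have h2 : Summable fun m : ℕ => ‖b‖ ^ m := summable_geometric_of_lt_one (norm_nonneg b) hb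
  refine Summable.of_norm_bounded (h1.mul_of_nonneg h2 (fun n => by positivity)
    fun m => by positivity) fun ⟨n, m⟩ => ?_
  rcases Nat.eq_zero_or_pos n with rfl | hn
  · simp
  · rw [mul_pow, ← pow_mul, norm_mul, norm_mul, ← mul_assoc, norm_pow w, Complex.norm_natCast]
    gcongr
    exact norm_pow_le_norm_pow_of_le hb (Nat.le_mul_of_pos_right m hn)

lemma tsum_lambert_row {w b : ℂ} (hb : ‖b‖ < 1) (n : ℕ) :
    ∑' m : ℕ, (n : ℂ) * (w * b ^ m) ^ n = n * w ^ n / (1 - b ^ n) := by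
  rcases eq_or_ne n 0 with rfl | hn
  · simp
  · have : ∀ m : ℕ, (n : ℂ) * (w * b ^ m) ^ n = n * w ^ n * (b ^ n) ^ m := fun m => by ring
    rw [tsum_congr this, tsum_mul_left, tsum_geometric_of_norm_lt_one (norm_pow_lt_one hb hn),
      div_eq_mul_inv]

/-- Expand 1/(1 - b^n) geometrically and interchange the sums; for fixed m the sum over n is Σ n t^n
= t/(1 - t)² with t = w b^m. -/
lemma hasSum_lambert {w b : ℂ} (hw : ‖w‖ < 1) (hb : ‖b‖ < 1) :
    HasSum (fun n : ℕ => (n : ℂ) * w ^ n / (1 - b ^ n)) (∑' m : ℕ, koebe (w * b ^ m)) := by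
  have hs := summable_lambert_double hw hb
  have h1 : ∀ m : ℕ, ∑' n : ℕ, (n : ℂ) * (w * b ^ m) ^ n = koebe (w * b ^ m) := fun m => by
    rw [tsum_coe_mul_geometric_of_norm_lt_one, koebe]
    rw [norm_mul]
    exact mul_lt_one_of_nonneg_of_lt_one_left (norm_nonneg _) hw
      (norm_pow b m ▸ pow_le_one₀ (norm_nonneg b) hb.le)
  have h2 := hs.prod
  simp only [tsum_lambert_row hb] at h2
  refine h2.hasSum_iff.mpr ?_
  rw [← tsum_congr h1, ← tsum_congr (tsum_lambert_row (w := w) hb)]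
  exact hs.tsum_comm.symm

lemma hasSum_legendreFive_lambert {ζ : ℂ} (hζ : 1 + ζ + ζ ^ 2 + ζ ^ 3 + ζ ^ 4 = 0) {a b : ℂ}
    (ha : ‖a‖ < 1) (hb : ‖b‖ < 1) :
    HasSum (fun n : ℕ => (ζ - ζ ^ 2 - ζ ^ 3 + ζ ^ 4) *
        (legendreFive n * ((n : ℂ) * a ^ n / (1 - b ^ n))))
      (∑' m : ℕ, koebe (ζ * a * b ^ m) - ∑' m : ℕ, koebe (ζ ^ 2 * a * b ^ m) -
        ∑' m : ℕ, koebe (ζ ^ 3 * a * b ^ m) + ∑' m : ℕ, koebe (ζ ^ 4 * a * b ^ m)) := by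
  have hn : ∀ k : ℕ, ‖ζ ^ k * a‖ < 1 := fun k => by
    rwa [norm_mul, norm_pow, norm_fifth_root hζ, one_pow, one_mul]
  have h1 := hn 1
  rw [pow_one] at h1
  convert (((hasSum_lambert h1 hb).sub (hasSum_lambert (hn 2) hb)).sub
    (hasSum_lambert (hn 3) hb)).add (hasSum_lambert (hn 4) hb) using 1
  · rfl
  funext n
  have := legendreFive_mul_gauss_sum hζ n
  simp only [mul_pow]
  linear_combination (n : ℂ) * a ^ n / (1 - b ^ n) * this

lemma tsum_eq_sum_residues {F : ℕ → ℂ} (hF : Summable F) {k : ℕ} (hk : k ≠ 0) :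
    ∑' n, F n = ∑ r ∈ Finset.range k, ∑' m, F (k * m + r) := by
  have h1 := hF.hasSum.tendsto_sum_nat.comp
    (tendsto_id.const_mul_atTop' (Nat.pos_of_ne_zero hk))
  have h2 := tendsto_finsetSum (Finset.range k) fun r _ =>
    (hF.comp_injective (i := fun m : ℕ => k * m + r) fun a b h => by
      simpa [hk] using h).hasSum.tendsto_sum_nat
  refine tendsto_nhds_unique h1 (h2.congr fun N => ?_)
  simp only [Function.comp, id]
  induction N with
  | zero => simp
  | succ N ih =>
    rw [mul_add_one, Finset.sum_range_add, ← ih, ← Finset.sum_add_distrib]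
    exact Finset.sum_congr rfl fun r _ => by rw [Finset.sum_range_succ]

lemma summable_legendreFive_mul {f : ℕ → ℂ} (hf : Summable f) :
    Summable fun n => legendreFive n * f n := by
  refine Summable.of_norm_bounded hf.norm fun n => ?_
  rw [norm_mul]
  exact mul_le_of_le_one_left (norm_nonneg _) (norm_legendreFive_le n)

lemma neg_koebe_neg (t : ℂ) : -koebe (-t) = t / (1 + t) ^ 2 := by
  rw [koebe, sub_neg_eq_add, neg_div, neg_neg]

lemma summable_div_one_add_sq {q : ℂ} (hq1 : ‖q‖ < 1) :
    Summable fun n : ℕ => q ^ n / (1 + q ^ n) ^ 2 := by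
  exact (summable_koebe hq1 (-1)).neg.congr fun n => by rw [neg_one_mul, neg_koebe_neg]

/-- Residues r and 5 - r carry the same symbol, as -1 is a square modulo 5, and give the two halves
of one `koebeSum`. The sign comes from t/(1 + t)² = -`koebe (-t)`. -/
lemma tsum_legendreFive_div_one_add_sq {q : ℂ} (hq : q ≠ 0) (hq1 : ‖q‖ < 1) :
    ∑' n : ℕ, legendreFive n * (q ^ n / (1 + q ^ n) ^ 2) =
      koebeSum (-q ^ 2) (q ^ 5) - koebeSum (-q) (q ^ 5) := by
  have e1 : q ^ 5 / -q = -q ^ 4 := by field_simp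
  have e2 : q ^ 5 / -q ^ 2 = -q ^ 3 := by field_simp
  have h : ∀ r m : ℕ, legendreFive (5 * m + r) * (q ^ (5 * m + r) / (1 + q ^ (5 * m + r)) ^ 2) =
      -legendreFive r * koebe (-q ^ r * (q ^ 5) ^ m) := fun r m => by
    rw [legendreFive_add_five_mul, ← neg_koebe_neg, ← pow_mul, pow_add]
    ring_nf
  rw [tsum_eq_sum_residues (summable_legendreFive_mul (summable_div_one_add_sq hq1))
    (show 5 ≠ 0 by norm_num)]
  simp only [h, tsum_mul_left, Finset.sum_range_succ, Finset.sum_range_zero, legendreFive_zero,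
    legendreFive_one, legendreFive_two, legendreFive_three, legendreFive_four, koebeSum, e1, e2,
    pow_one]
  ring

lemma summable_koebe_pow {q : ℂ} (hq1 : ‖q‖ < 1) :
    Summable fun n : ℕ => q ^ n / (1 - q ^ n) ^ 2 := by
  simpa [koebe] using summable_koebe hq1 1

/-- Among the odd residues modulo 10, the pair 1, 9 has symbol 1, the pair 3, 7 has symbol -1, and 5
drops out. -/
lemma tsum_odd_legendreFive {q : ℂ} (hq : q ≠ 0) (hq1 : ‖q‖ < 1) :
    ∑' n : {n : ℕ // Odd n}, legendreFive n * (q ^ (n : ℕ) / (1 - q ^ (n : ℕ)) ^ 2) =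
      koebeSum q (q ^ 10) - koebeSum (q ^ 3) (q ^ 10) := by
  have e1 : q ^ 10 / q = q ^ 9 := by field_simp
  have e2 : q ^ 10 / q ^ 3 = q ^ 7 := by field_simp
  have h : ∀ r m : ℕ, Set.indicator {n : ℕ | Odd n}
      (fun n => legendreFive n * (q ^ n / (1 - q ^ n) ^ 2)) (10 * m + r) =
      (if Odd r then legendreFive r else 0) * koebe (q ^ r * (q ^ 10) ^ m) := fun r m => by
    have ho : Odd (10 * m + r) ↔ Odd r := by grind
    by_cases hr : Odd r
    · rw [Set.indicator_of_mem (show _ ∈ {n : ℕ | Odd n} from ho.mpr hr), if_pos hr,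
        show 10 * m + r = 5 * (2 * m) + r by ring, legendreFive_add_five_mul, koebe,
        ← pow_mul, ← pow_add]
      ring_nf
    · rw [Set.indicator_of_notMem (show _ ∉ {n : ℕ | Odd n} from fun h => hr (ho.mp h)), if_neg hr,
        zero_mul]
  have hs := (summable_legendreFive_mul (summable_koebe_pow hq1)).indicator {n : ℕ | Odd n}
  refine (tsum_subtype {n : ℕ | Odd n}
    fun n => legendreFive n * (q ^ n / (1 - q ^ n) ^ 2)).trans ?_
  rw [tsum_eq_sum_residues hs (show 10 ≠ 0 by norm_num)]
  have h7 : legendreFive 7 = -1 := (legendreFive_add_five_mul 1 2).trans legendreFive_two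
  have h9 : legendreFive 9 = 1 := (legendreFive_add_five_mul 1 4).trans legendreFive_four
  have h55 : legendreFive 5 = 0 := (legendreFive_add_five_mul 1 0).trans legendreFive_zero
  simp only [h, tsum_mul_left, Finset.sum_range_succ, Finset.sum_range_zero, koebeSum, e1, e2]
  simp [legendreFive_one, legendreFive_three, h7, h9, h55, Nat.odd_iff]
  ring

lemma gauss_sum_ne_zero {ζ : ℂ} (hζ : 1 + ζ + ζ ^ 2 + ζ ^ 3 + ζ ^ 4 = 0) :
    ζ - ζ ^ 2 - ζ ^ 3 + ζ ^ 4 ≠ 0 := by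
  intro h
  have := gauss_sum_sq hζ
  rw [h] at this
  norm_num at this

lemma gauss_sum_mul_tsum_sq {ζ : ℂ} (hζ : 1 + ζ + ζ ^ 2 + ζ ^ 3 + ζ ^ 4 = 0) {q : ℂ}
    (hq : q ≠ 0) (hq1 : ‖q‖ < 1) :
    (ζ - ζ ^ 2 - ζ ^ 3 + ζ ^ 4) *
      ∑' n : ℕ, legendreFive n * ((n : ℂ) * q ^ n / (1 - (q ^ 2) ^ n)) =
      koebeSum (ζ * q) (q ^ 2) - koebeSum (ζ ^ 2 * q) (q ^ 2) := by
  have h5 := fifth_root_pow_five hζ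
  have h0 := fifth_root_ne_zero hζ
  have e1 : q ^ 2 / (ζ * q) = ζ ^ 4 * q := by
    rw [div_eq_iff (mul_ne_zero h0 hq)]; linear_combination -q ^ 2 * h5
  have e2 : q ^ 2 / (ζ ^ 2 * q) = ζ ^ 3 * q := by
    rw [div_eq_iff (mul_ne_zero (pow_ne_zero 2 h0) hq)]; linear_combination -q ^ 2 * h5
  rw [← tsum_mul_left,
    (hasSum_legendreFive_lambert hζ hq1 (norm_pow_lt_one hq1 two_ne_zero)).tsum_eq, koebeSum,
    koebeSum, e1, e2]
  ring

/-- The points -ζ, -ζ² lie on the unit circle, so the leading terms of their `koebeSum` are not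
covered by the Lambert expansion. Their difference equals the Gauss sum, which is the origin of the
summand 1. -/
lemma gauss_sum_mul_one_add_tsum {ζ : ℂ} (hζ : 1 + ζ + ζ ^ 2 + ζ ^ 3 + ζ ^ 4 = 0) {q : ℂ}
    (hq1 : ‖q‖ < 1) :
    (ζ - ζ ^ 2 - ζ ^ 3 + ζ ^ 4) *
      (1 + ∑' n : ℕ, legendreFive n * ((n : ℂ) * (-q) ^ n / (1 - q ^ n))) =
      koebeSum (-ζ) q - koebeSum (-ζ ^ 2) q := by
  have h5 := fifth_root_pow_five hζ
  have h0 := fifth_root_ne_zero hζ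
  have e1 : q / -ζ = ζ ^ 4 * -q := by
    rw [div_eq_iff (neg_ne_zero.mpr h0)]; linear_combination -q * h5
  have e2 : q / -ζ ^ 2 = ζ ^ 3 * -q := by
    rw [div_eq_iff (neg_ne_zero.mpr (pow_ne_zero 2 h0))]; linear_combination -q * h5
  have hz : ∀ a : ℂ, ∑' m : ℕ, koebe (-a * q ^ m) =
      koebe (-a) + ∑' m : ℕ, koebe (a * -q * q ^ m) := by
    intro a
    rw [(summable_koebe hq1 (-a)).tsum_eq_zero_add, pow_zero, mul_one]
    congr 1
    exact tsum_congr fun m => by ring_nf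
  have hk : koebe (-ζ) - koebe (-ζ ^ 2) = ζ - ζ ^ 2 - ζ ^ 3 + ζ ^ 4 := by
    have n1 : 1 + ζ ≠ 0 := fun h => by
      have : ζ = -1 := by linear_combination h
      rw [this] at hζ
      norm_num at hζ
    have n2 : 1 + ζ ^ 2 ≠ 0 := fun h => by
      apply one_ne_zero (α := ℂ)
      linear_combination hζ - (ζ + ζ ^ 2) * h
    rw [koebe, koebe, sub_neg_eq_add, sub_neg_eq_add,
      div_sub_div _ _ (pow_ne_zero 2 n1) (pow_ne_zero 2 n2),
      div_eq_iff (mul_ne_zero (pow_ne_zero 2 n1) (pow_ne_zero 2 n2))]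
    linear_combination (-(ζ ^ 2 - ζ) - (ζ - ζ ^ 2 - ζ ^ 3 + ζ ^ 4) * ζ ^ 3) * h5 -
      (ζ - ζ ^ 2 - ζ ^ 3 + ζ ^ 4) * (1 + ζ + ζ ^ 2 + ζ ^ 3 - ζ ^ 4) * hζ
  rw [mul_add, ← tsum_mul_left,
    (hasSum_legendreFive_lambert hζ (by rwa [norm_neg]) hq1).tsum_eq, koebeSum,
    koebeSum, e1, e2, hz, hz, ← hk]
  ring

lemma exists_fifth_root : ∃ ζ : ℂ, 1 + ζ + ζ ^ 2 + ζ ^ 3 + ζ ^ 4 = 0 := by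
  have h := (Complex.isPrimitiveRoot_exp 5 (by norm_num)).geom_sum_eq_zero (by norm_num)
  simp only [Finset.sum_range_succ, Finset.sum_range_zero, zero_add, pow_zero, pow_one] at h
  exact ⟨_, h⟩

lemma summable_legendreFive_lambert {a b : ℂ} (ha : ‖a‖ < 1) (hb : ‖b‖ < 1) :
    Summable fun n : ℕ => legendreFive n * ((n : ℂ) * a ^ n / (1 - b ^ n)) :=
  summable_legendreFive_mul (hasSum_lambert ha hb).summable

/-! ### The four expansions for q ≠ 0 -/

/-- The two expansions for `φ`, at `-q`. -/
theorem ramanujanPhi_neg_expansions {q : ℂ} (hq : q ≠ 0) (hq1 : ‖q‖ < 1) :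
    ramanujanPhi (-q) * ramanujanPhi (-q ^ 5) ^ 3 =
      1 + ∑' n : ℕ, legendreFive n * ((n : ℂ) * (-q) ^ n / (1 - q ^ n)) -
        ∑' n : ℕ, legendreFive n * (q ^ n / (1 + q ^ n) ^ 2) ∧
    ramanujanPhi (-q) ^ 3 * ramanujanPhi (-q ^ 5) =
      1 + ∑' n : ℕ, legendreFive n * ((n : ℂ) * (-q) ^ n / (1 - q ^ n)) -
        5 * ∑' n : ℕ, legendreFive n * (q ^ n / (1 + q ^ n) ^ 2) := by
  obtain ⟨ζ, hζ⟩ := exists_fifth_root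
  have hq5 := norm_pow_lt_one hq1 (show 5 ≠ 0 by norm_num)
  have h1 := ramanujanPhi_neg_mul_eulerProd hq hq1
  have h2 := ramanujanPhi_neg_mul_eulerProd (pow_ne_zero 5 hq) hq5
  rw [← pow_mul] at h2
  norm_num at h2
  have hA := eulerProd_identity_one hq hq1
  have hB := eulerProd_identity_five hq hq1 hζ
  have h3 := koebeSum_sub_five hq hq1
  rw [← neg_sub, ← tsum_legendreFive_div_one_add_sq hq hq1] at h3
  have h4 := koebeSum_sub_fifth_root_one hζ hq hq1
  rw [← gauss_sum_mul_one_add_tsum hζ hq1, mul_assoc] at h4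
  replace h4 := mul_left_cancel₀ (gauss_sum_ne_zero hζ) h4
  have n1 := eulerProd_ne_zero (norm_pow_lt_one hq1 two_ne_zero)
  have n2 := eulerProd_ne_zero (norm_pow_lt_one hq1 (show 10 ≠ 0 by norm_num))
  generalize ∑' n : ℕ, legendreFive n * (q ^ n / (1 + q ^ n) ^ 2) = S at *
  generalize 1 + ∑' n : ℕ, legendreFive n * ((n : ℂ) * (-q) ^ n / (1 - q ^ n)) = T at *
  generalize ramanujanPhi (-q) = f at *
  generalize ramanujanPhi (-q ^ 5) = g at *
  generalize eulerProd (q ^ 2) = e2 at *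
  generalize eulerProd (q ^ 5) = e5 at *
  generalize eulerProd (q ^ 10) = e10 at *
  generalize eulerProd q = e1 at *
  -- Now T = e1 e2² e5³/e10² and S = q e1³ e5 e10²/e2². Up to a common factor, T - S is the left
  -- side of `hA` and T - 5S that of `hB`.
  constructor
  · have h5 : f * g ^ 3 * (e2 * e10 ^ 3) = e1 ^ 2 * (e5 ^ 2) ^ 3 := by
      rw [← h1, ← h2]
      ring
    apply mul_right_cancel₀ (mul_ne_zero (pow_ne_zero 2 n1) (pow_ne_zero 3 n2))
    linear_combination e2 * h5 - e2 ^ 2 * e10 * h4 - e10 ^ 3 * h3 - e1 * e5 * hA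
  · have h5 : f ^ 3 * g * (e2 ^ 3 * e10) = (e1 ^ 2) ^ 3 * e5 ^ 2 := by
      rw [← h1, ← h2]
      ring
    apply mul_right_cancel₀ (mul_ne_zero (pow_ne_zero 3 n1) (pow_ne_zero 2 n2))
    linear_combination e10 * h5 - e2 ^ 3 * h4 - 5 * e10 ^ 2 * e2 * h3 - e1 * e5 * hB

/-- The two expansions for `ψ`. -/
theorem ramanujanPsi_expansions {q : ℂ} (hq : q ≠ 0) (hq1 : ‖q‖ < 1) :
    4 * q * ramanujanPsi q ^ 3 * ramanujanPsi (q ^ 5) =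
      -(∑' n : ℕ, legendreFive n * ((n : ℂ) * q ^ n / (1 - (q ^ 2) ^ n))) +
        5 * ∑' n : {n : ℕ // Odd n}, legendreFive n * (q ^ (n : ℕ) / (1 - q ^ (n : ℕ)) ^ 2) ∧
    4 * q ^ 2 * ramanujanPsi q * ramanujanPsi (q ^ 5) ^ 3 =
      -(∑' n : ℕ, legendreFive n * ((n : ℂ) * q ^ n / (1 - (q ^ 2) ^ n))) +
        ∑' n : {n : ℕ // Odd n}, legendreFive n * (q ^ (n : ℕ) / (1 - q ^ (n : ℕ)) ^ 2) := by
  obtain ⟨ζ, hζ⟩ := exists_fifth_root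
  have hq5 := norm_pow_lt_one hq1 (show 5 ≠ 0 by norm_num)
  have h1 := ramanujanPsi_mul_eulerProd hq hq1
  have h2 := ramanujanPsi_mul_eulerProd (pow_ne_zero 5 hq) hq5
  rw [← pow_mul] at h2
  norm_num at h2
  have hA := eulerProd_identity_one hq hq1
  have hB := eulerProd_identity_five hq hq1 hζ
  have h3 := koebeSum_sub_ten hq hq1
  rw [← tsum_odd_legendreFive hq hq1] at h3
  have h4 := koebeSum_sub_fifth_root_two hζ hq hq1
  rw [← gauss_sum_mul_tsum_sq hζ hq hq1, mul_assoc] at h4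
  replace h4 := mul_left_cancel₀ (gauss_sum_ne_zero hζ) h4
  have n1 := eulerProd_ne_zero hq1
  have n2 := eulerProd_ne_zero hq5
  generalize ∑' n : {n : ℕ // Odd n},
    legendreFive n * (q ^ (n : ℕ) / (1 - q ^ (n : ℕ)) ^ 2) = S at *
  generalize ∑' n : ℕ, legendreFive n * ((n : ℂ) * q ^ n / (1 - (q ^ 2) ^ n)) = T at *
  generalize ramanujanPsi q = f at *
  generalize ramanujanPsi (q ^ 5) = g at *
  generalize eulerProd (q ^ 2) = e2 at *
  generalize eulerProd (q ^ 5) = e5 at *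
  generalize eulerProd (q ^ 10) = e10 at *
  generalize eulerProd q = e1 at *
  -- Now T = q e1² e2 e10³/e5² and S = q e2³ e5² e10/e1². The combination 5 e2 `hA` - e10 `hB`
  -- cancels the terms containing q, and e2 `hA` - e10 `hB` cancels those in e2⁵; both leave the
  -- coefficient 4.
  constructor
  · have h5 : f ^ 3 * g * (e1 ^ 3 * e5) = (e2 ^ 2) ^ 3 * e10 ^ 2 := by
      rw [← h1, ← h2]
      ring
    apply mul_right_cancel₀ (mul_ne_zero (pow_ne_zero 3 n1) (pow_ne_zero 3 n2))
    linear_combination 4 * q * e5 ^ 2 * h5 + e1 ^ 3 * e5 * h4 - 5 * e1 * e5 ^ 3 * h3 -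
      q * e2 * e10 ^ 2 * hB + 5 * q * e2 ^ 2 * e10 * hA
  · have h5 : f * g ^ 3 * (e1 * e5 ^ 3) = e2 ^ 2 * (e10 ^ 2) ^ 3 := by
      rw [← h1, ← h2]
      ring
    apply mul_right_cancel₀ (mul_ne_zero (pow_ne_zero 3 n1) (pow_ne_zero 3 n2))
    linear_combination 4 * q ^ 2 * e1 ^ 2 * h5 + e1 ^ 3 * e5 * h4 - e1 * e5 ^ 3 * h3 -
      q * e2 * e10 ^ 2 * hB + q * e2 ^ 2 * e10 * hA

/-! ### The case q = 0 and the theorem -/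

lemma ramanujanThetaTerm_zero {k : ℕ} (hk : k ≠ 0) {n : ℤ} (hn : n ≠ 0) :
    ramanujanThetaTerm 0 (0 ^ k) n = 0 := by
  have h1 := triangle_mul_two n
  have h2 := triangle_mul_two (n + 1)
  rw [add_sub_cancel_right, mul_comm (n + 1)] at h2
  rw [ramanujanThetaTerm, zero_pow hk]
  rcases eq_or_ne (n * (n + 1) / 2) 0 with h | h
  · have h' : n * (n - 1) / 2 ≠ 0 := by
      intro h3
      rw [h3] at h1
      rw [h] at h2
      exact hn (by linarith)
    rw [zero_zpow _ h', mul_zero]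
  · rw [zero_zpow _ h, zero_mul]

lemma ramanujanTheta_zero {k : ℕ} (hk : k ≠ 0) : ramanujanTheta 0 (0 ^ k) = 1 := by
  rw [ramanujanTheta, tsum_eq_single 0 fun n hn => ramanujanThetaTerm_zero hk hn]
  simp [ramanujanThetaTerm]

lemma summable_ramanujanThetaTerm_zero {k : ℕ} (hk : k ≠ 0) :
    Summable fun n : ℤ => ramanujanThetaTerm 0 (0 ^ k) n :=
  summable_of_ne_finset_zero (s := {0}) fun n hn =>
    ramanujanThetaTerm_zero hk (by simpa using hn)

lemma ramanujanPhi_zero : ramanujanPhi 0 = 1 := by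
  simpa [ramanujanPhi] using ramanujanTheta_zero one_ne_zero

theorem corollary7p3 (q : ℂ) (hq : ‖q‖ < 1) :
    -- the theta series and the Lambert series converge absolutely
    (Summable (fun n : ℤ => ramanujanThetaTerm q q n) ∧
      Summable (fun n : ℤ => ramanujanThetaTerm q (q ^ 3) n) ∧
      Summable (fun n : ℕ+ => legendreFive n * ((n : ℂ) * q ^ (n : ℕ) / (1 - (-q) ^ (n : ℕ)))) ∧
      Summable (fun n : ℕ+ => legendreFive n * ((-q) ^ (n : ℕ) / (1 + (-q) ^ (n : ℕ)) ^ 2)) ∧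
      Summable (fun n : ℕ+ => legendreFive n * ((n : ℂ) * q ^ (n : ℕ) / (1 - q ^ (2 * (n : ℕ))))) ∧
      Summable (fun n : {n : ℕ // Odd n} =>
        legendreFive n * (q ^ (n : ℕ) / (1 - q ^ (n : ℕ)) ^ 2))) ∧
    -- the four expansions
    ramanujanPhi q * ramanujanPhi (q ^ 5) ^ 3 =
      1 + ∑' n : ℕ+, legendreFive n * ((n : ℂ) * q ^ (n : ℕ) / (1 - (-q) ^ (n : ℕ)))
        - ∑' n : ℕ+, legendreFive n * ((-q) ^ (n : ℕ) / (1 + (-q) ^ (n : ℕ)) ^ 2) ∧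
    ramanujanPhi q ^ 3 * ramanujanPhi (q ^ 5) =
      1 + ∑' n : ℕ+, legendreFive n * ((n : ℂ) * q ^ (n : ℕ) / (1 - (-q) ^ (n : ℕ)))
        - 5 * ∑' n : ℕ+, legendreFive n * ((-q) ^ (n : ℕ) / (1 + (-q) ^ (n : ℕ)) ^ 2) ∧
    4 * q * ramanujanPsi q ^ 3 * ramanujanPsi (q ^ 5) =
      -(∑' n : ℕ+, legendreFive n * ((n : ℂ) * q ^ (n : ℕ) / (1 - q ^ (2 * (n : ℕ)))))
        + 5 * ∑' n : {n : ℕ // Odd n},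
            legendreFive n * (q ^ (n : ℕ) / (1 - q ^ (n : ℕ)) ^ 2) ∧
    4 * q ^ 2 * ramanujanPsi q * ramanujanPsi (q ^ 5) ^ 3 =
      -(∑' n : ℕ+, legendreFive n * ((n : ℂ) * q ^ (n : ℕ) / (1 - q ^ (2 * (n : ℕ)))))
        + ∑' n : {n : ℕ // Odd n},
            legendreFive n * (q ^ (n : ℕ) / (1 - q ^ (n : ℕ)) ^ 2) := by
  have hq' : ‖-q‖ < 1 := by rwa [norm_neg]
  have hq2 := norm_pow_lt_one hq two_ne_zero
  have s1 := summable_legendreFive_lambert hq hq'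
  have s2 := summable_legendreFive_mul (summable_div_one_add_sq hq')
  have s3 := summable_legendreFive_lambert hq hq2
  have s4 := summable_legendreFive_mul (summable_koebe_pow hq)
  simp only [pow_mul]
  refine ⟨⟨?_, ?_, s1.comp_injective PNat.coe_injective, s2.comp_injective PNat.coe_injective,
    s3.comp_injective PNat.coe_injective, s4.comp_injective Subtype.coe_injective⟩, ?_⟩
  · rcases eq_or_ne q 0 with rfl | h0
    · simpa using summable_ramanujanThetaTerm_zero one_ne_zero
    · have h := summable_thetaTerm (neg_ne_zero.mpr h0) (pow_ne_zero 2 (neg_ne_zero.mpr h0))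
        (norm_pow_lt_one hq' two_ne_zero)
      simpa using h.congr fun n => (ramanujanThetaTerm_neg_self (neg_ne_zero.mpr h0) n).symm
  · rcases eq_or_ne q 0 with rfl | h0
    · exact summable_ramanujanThetaTerm_zero three_ne_zero
    · have h := summable_thetaTerm (neg_ne_zero.mpr h0) (pow_ne_zero 4 h0)
        (norm_pow_lt_one hq four_ne_zero)
      exact h.congr fun n => (ramanujanThetaTerm_cube h0 n).symm
  -- Adding n = 0 changes nothing: the factor n kills that term in the first and third series, while
  -- in the second only (0/5) = 0 does, the quotient being 1/4.
  rw [tsum_pnat_eq_tsum_of_eq_zero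
      (f := fun n : ℕ => legendreFive n * ((n : ℂ) * q ^ n / (1 - (-q) ^ n))) (by simp),
    tsum_pnat_eq_tsum_of_eq_zero
      (f := fun n : ℕ => legendreFive n * ((-q) ^ n / (1 + (-q) ^ n) ^ 2))
      (by simp [legendreFive_zero]),
    tsum_pnat_eq_tsum_of_eq_zero
      (f := fun n : ℕ => legendreFive n * ((n : ℂ) * q ^ n / (1 - (q ^ 2) ^ n))) (by simp)]
  rcases eq_or_ne q 0 with rfl | h0
  · have z1 : ∀ (n : ℕ) (d : ℂ), legendreFive n * ((n : ℂ) * 0 ^ n / d) = 0 := fun n d => by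
      rcases eq_or_ne n 0 with rfl | hn <;> simp [*]
    have z2 : ∀ (n : ℕ) (d : ℂ), legendreFive n * (0 ^ n / d) = 0 := fun n d => by
      rcases eq_or_ne n 0 with rfl | hn <;> simp [*, legendreFive_zero]
    simp [z1, z2, ramanujanPhi_zero]
  · obtain ⟨h1, h2⟩ := ramanujanPhi_neg_expansions (neg_ne_zero.mpr h0) hq'
    obtain ⟨h3, h4⟩ := ramanujanPsi_expansions h0 hq
    rw [neg_neg, show -(-q) ^ 5 = q ^ 5 by ring] at h1 h2
    exact ⟨h1, h2, h3, h4⟩
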